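/- Let $q:[0,\pi]\to\mathbb{R}$ have cosine coefficients $$q_k=\frac{2}{\pi}\int_0^\pi q(x)\cos(kx)\,dx,\qquad k=0,1,2,\dots,$$ with $\sum_k|q_k|<\infty$, and assume that $q(x)=\frac{q_0}{2}+\sum_{k=1}^\infty q_k\cos(kx)$ for every $x\in[0,\pi]$. Consider the Dirichlet problem $-u''+qu=\lambda u$ on $(0,\pi)$, $u(0)=u(\pi)=0$, in the weak sense: $\lambda\in\mathbb{R}$ is an eigenvalue if there is $0\neq u\in H^1_0(0,\pi)$ with $\int_0^\pi u'v'\,dx+\int_0^\pi quv\,dx=\lambda\int_0^\pi uv\,dx$ for all $v\in H^1_0(0,\pi)$. Then all eigenvalues can be listed in a sequence $\lambda_1\le\lambda_2\le\cdots$ in which each is repeated according to its multiplicity (the dimension of its eigenspace), and for every $n\ge1$ $$\sum_{k=1}^n\Bigl(\lambda_k-k^2-\frac{q_0}{2}\Bigr)\le-\frac12\sum_{k=1}^n q_{2k}.$$ If equality holds for some $n\ge1$, then $q$ is constant on $[0,\pi]$. Moreover, as $n\to\infty$, the right-hand side converges: $$-\frac12\sum_{k=1}^n q_{2k}\longrightarrow\frac12\cdot\frac1\pi\int_0^\pi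 q(x)\,dx-\frac{q(0)+q(\pi)}{4}.$$ -/

import Mathlib

open MeasureTheory Set Filter
open scoped Topology ContDiff

noncomputable section

/-- Lebesgue measure on the interval `(0, π)`. -/
abbrev intervalMeasure : Measure ℝ := volume.restrict (Ioo 0 Real.pi)

/-- The real Hilbert space `L²(0, π)`. -/
abbrev IntervalL2 : Type := Lp ℝ 2 intervalMeasure

/-- The pairs `(φ, φ')`, as elements of `L²(0, π) × L²(0, π)`, where `φ` is a smooth function with
compact support in the open interval `(0, π)`. -/
def testPairs : Set (IntervalL2 × IntervalL2) :=
  {p | ∃ φ : ℝ → ℝ, ContDiff ℝ ∞ φ ∧ HasCompactSupport φ ∧ tsupport φ ⊆ Ioo 0 Real.pi ∧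
    p.1 =ᵐ[intervalMeasure] φ ∧ p.2 =ᵐ[intervalMeasure] deriv φ}

/-- The Sobolev space `H¹₀(0, π)`, the closure of the test functions in the `H¹` topology. A
function `u` is represented by the pair `(u, u')` formed with its weak derivative, so that the `H¹`
topology is the topology of `L² × L²`. The set `testPairs` is itself a linear subspace, so taking
its span adds nothing. -/
def sobolevH10 : Submodule ℝ (IntervalL2 × IntervalL2) :=
  (Submodule.span ℝ testPairs).topologicalClosure

/-- The space of weak solutions `u ∈ H¹₀(0, π)` of `-u'' + q u = μ u`: the functions `u` for which
`∫ u' v' + ∫ q u v = μ ∫ u v` for all `v ∈ H¹₀(0, π)`, the potential term being integrable. -/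
def dirichletEigenspace (q : ℝ → ℝ) (μ : ℝ) : Submodule ℝ IntervalL2 where
  carrier := {u | ∃ u' : IntervalL2, (u, u') ∈ sobolevH10 ∧
    ∀ v v' : IntervalL2, (v, v') ∈ sobolevH10 →
      Integrable (fun x => q x * u x * v x) intervalMeasure ∧
      inner ℝ u' v' + ∫ x, q x * u x * v x ∂intervalMeasure = μ * inner ℝ u v}
  zero_mem' := by
    refine ⟨0, Submodule.zero_mem sobolevH10, fun v v' _ => ?_⟩
    have h : (fun x => q x * (0 : IntervalL2) x * v x) =ᵐ[intervalMeasure] fun _ => (0 : ℝ) := by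
      filter_upwards [Lp.coeFn_zero ℝ 2 intervalMeasure] with x hx
      rw [hx, Pi.zero_apply, mul_zero, zero_mul]
    refine ⟨(integrable_congr h).2 (integrable_zero _ _ _), ?_⟩
    rw [integral_congr_ae h]
    simp
  add_mem' := by
    rintro u w ⟨u', hu, hu2⟩ ⟨w', hw, hw2⟩
    refine ⟨u' + w', Submodule.add_mem sobolevH10 hu hw, fun v v' hv => ?_⟩
    obtain ⟨i1, e1⟩ := hu2 v v' hv
    obtain ⟨i2, e2⟩ := hw2 v v' hv
    have h : (fun x => q x * (u + w : IntervalL2) x * v x) =ᵐ[intervalMeasure]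
        fun x => q x * u x * v x + q x * w x * v x := by
      filter_upwards [Lp.coeFn_add u w] with x hx
      rw [hx, Pi.add_apply]
      ring
    refine ⟨(integrable_congr h).2 (i1.add i2), ?_⟩
    rw [integral_congr_ae h, integral_add i1 i2, inner_add_left, inner_add_left]
    linarith
  smul_mem' := by
    rintro c u ⟨u', hu, hu2⟩
    refine ⟨c • u', Submodule.smul_mem sobolevH10 c hu, fun v v' hv => ?_⟩
    obtain ⟨i1, e1⟩ := hu2 v v' hv
    have h : (fun x => q x * (c • u : IntervalL2) x * v x) =ᵐ[intervalMeasure]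
        fun x => c * (q x * u x * v x) := by
      filter_upwards [Lp.coeFn_smul c u] with x hx
      rw [hx, Pi.smul_apply, smul_eq_mul]
      ring
    refine ⟨(integrable_congr h).2 (i1.const_mul c), ?_⟩
    rw [integral_congr_ae h, integral_const_mul, real_inner_smul_left, real_inner_smul_left]
    linear_combination c * e1

/-- `ev 1 ≤ ev 2 ≤ …` is the list of all eigenvalues of the Dirichlet problem `-u'' + q u = μ u` on
`(0, π)`, each repeated according to its multiplicity, the dimension of the eigenspace. (The value
`ev 0` plays no role.) -/
structure IsDirichletEigenvalueSeq (q : ℝ → ℝ) (ev : ℕ → ℝ) : Prop where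
  mono : MonotoneOn ev (Ici 1)
  mult : ∀ μ : ℝ, {k : ℕ | 1 ≤ k ∧ ev k = μ}.encard =
    Cardinal.toENat (Module.rank ℝ (dirichletEigenspace q μ))

/-- The cosine coefficient `q_k = (2/π) ∫₀^π q(x) cos(kx) dx`. -/
def cosCoeff (q : ℝ → ℝ) (k : ℕ) : ℝ :=
  2 / Real.pi * ∫ x in (0 : ℝ)..Real.pi, q x * Real.cos (k * x)

/-- On `[0, π]` the function `q` is the sum of its cosine series
`q_0 / 2 + ∑_{k ≥ 1} q_k cos(kx)`, which converges absolutely. -/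
structure HasCosineExpansion (q : ℝ → ℝ) : Prop where
  summable_abs : Summable fun k : ℕ => |cosCoeff q k|
  hasSum : ∀ x ∈ Icc (0 : ℝ) Real.pi,
    HasSum (fun k : ℕ => cosCoeff q (k + 1) * Real.cos (((k + 1 : ℕ) : ℝ) * x))
      (q x - cosCoeff q 0 / 2)

end

/-! The functions `√(2/π) sin (kx)` are orthonormal in `L²(0, π)`, and by the product-to-sum formula
the form `∫ u'² + ∫ q u²` takes the value `k² + (q_0 - q_{2k}) / 2` at the `k`-th one. Ky Fan's
inequality (`sum_weakEigenvalue_le`) bounds the sum of the first `n` eigenvalues by the sum of these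
values, which is the claimed estimate.

If equality holds, rotating a trial function slightly towards a sine of frequency above `n` cannot
lower the sum, so the form vanishes between the two (`weakForm_eq_zero_of_sum_weakEigenvalue_eq`).
For the frequencies `n` and `n + m` this reads `q_m = q_{m+2n}`. Thus `(q_m)` with `m ≥ 1` is
periodic; being summable, it is zero, and `q` is constant. The limit comes from averaging the cosine
series at `0` and `π`, where odd frequencies cancel.

The eigenvalue sequence and an orthonormal eigenbasis come from the spectral theorem for a compact
resolvent (`exists_compact_resolvent`). The embedding of `H¹₀` in `L²` is compact because `k` times
the `k`-th sine coefficient of `u` is the `k`-th cosine coefficient of `u'`, so the sine tails are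
uniformly small. Abstractly, `V` is `H¹₀`, `H` is `L²`, `J` is the embedding, and `Q` is
multiplication by `q - 1`, since the inner product of `V` already contains `∫ u v`. -/

section WeakEigenvalueProblem

/-! ### Weak eigenvalue problems and their compact resolvent -/

open InnerProductSpace

variable {V H : Type*} [NormedAddCommGroup V] [InnerProductSpace ℝ V]
  [NormedAddCommGroup H] [InnerProductSpace ℝ H]

/-- The bilinear form `⟪w, z⟫ + ⟪Q J w, J z⟫` on `V`. -/
noncomputable def weakForm (J : V →L[ℝ] H) (Q : H →L[ℝ] H) (w z : V) : ℝ :=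
  inner ℝ w z + inner ℝ (Q (J w)) (J z)

/-- The vectors `J w` for which `weakForm J Q w z = μ ⟪J w, J z⟫` for all `z`. -/
def weakEigenspace (J : V →L[ℝ] H) (Q : H →L[ℝ] H) (μ : ℝ) : Submodule ℝ H where
  carrier := {u | ∃ w, J w = u ∧ ∀ z, weakForm J Q w z = μ * inner ℝ (J w) (J z)}
  zero_mem' := ⟨0, by simp [weakForm]⟩
  add_mem' := by
    rintro _ _ ⟨w, rfl, hw⟩ ⟨y, rfl, hy⟩
    refine ⟨w + y, map_add _ _ _, fun z => ?_⟩
    have h1 := hw z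
    have h2 := hy z
    simp only [weakForm, map_add, inner_add_left] at *
    linarith
  smul_mem' := by
    rintro c _ ⟨w, rfl, hw⟩
    refine ⟨c • w, map_smul _ _ _, fun z => ?_⟩
    have h1 := hw z
    simp only [weakForm, map_smul, real_inner_smul_left] at *
    linear_combination c * h1

variable {J : V →L[ℝ] H} {Q : H →L[ℝ] H}

theorem weakForm_comm (hQ : Q.IsSymmetric) (w z : V) :
    weakForm J Q w z = weakForm J Q z w := by
  have h : inner ℝ (Q (J w)) (J z) = inner ℝ (J w) (Q (J z)) := hQ _ _
  rw [weakForm, weakForm, real_inner_comm, h, real_inner_comm (J w)]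

theorem weakForm_add_left (w₁ w₂ z : V) :
    weakForm J Q (w₁ + w₂) z = weakForm J Q w₁ z + weakForm J Q w₂ z := by
  simp only [weakForm, map_add, inner_add_left]; ring

theorem weakForm_add_right (w z₁ z₂ : V) :
    weakForm J Q w (z₁ + z₂) = weakForm J Q w z₁ + weakForm J Q w z₂ := by
  simp only [weakForm, map_add, inner_add_right]; ring

theorem weakForm_smul_left (c : ℝ) (w z : V) :
    weakForm J Q (c • w) z = c * weakForm J Q w z := by
  simp only [weakForm, map_smul, real_inner_smul_left]; ring

theorem weakForm_smul_right (c : ℝ) (w z : V) :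
    weakForm J Q w (c • z) = c * weakForm J Q w z := by
  simp only [weakForm, map_smul, real_inner_smul_right]; ring

theorem inner_eq_zero_of_mem_weakEigenspace (hQ : Q.IsSymmetric) {μ ν : ℝ} (h : μ ≠ ν) {u v : H}
    (hu : u ∈ weakEigenspace J Q μ) (hv : v ∈ weakEigenspace J Q ν) : inner ℝ u v = 0 := by
  obtain ⟨w, rfl, hw⟩ := hu
  obtain ⟨z, rfl, hz⟩ := hv
  have h1 := hw z
  rw [weakForm_comm hQ, hz w, real_inner_comm] at h1
  have : (μ - ν) * inner ℝ (J w) (J z) = 0 := by linarith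
  exact (mul_eq_zero.1 this).resolve_left (sub_ne_zero.2 h)

theorem orthogonalFamily_weakEigenspace (hQ : Q.IsSymmetric) :
    OrthogonalFamily ℝ (fun μ => weakEigenspace J Q μ)
      fun μ => (weakEigenspace J Q μ).subtypeₗᵢ :=
  fun _ _ h u v => inner_eq_zero_of_mem_weakEigenspace hQ h u.2 v.2

variable [CompleteSpace V] [CompleteSpace H]

/-- The weak eigenspaces are the eigenspaces of a compact symmetric injective operator. -/
theorem exists_compact_resolvent (hQ : Q.IsSymmetric) (hJ : IsCompactOperator J)
    (hd : DenseRange J) {c : ℝ} (hc : ∀ u, -(c * ‖u‖ ^ 2) ≤ inner ℝ (Q u) u) :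
    ∃ S : H →L[ℝ] H, IsCompactOperator S ∧ S.IsSymmetric ∧
      (∀ μ, μ + c ≤ 0 → weakEigenspace J Q μ = ⊥) ∧
      (∀ μ, 0 < μ + c →
        weakEigenspace J Q μ = Module.End.eigenspace (S : Module.End ℝ H) (μ + c)⁻¹) ∧
      ∀ ν ≤ 0, Module.End.eigenspace (S : Module.End ℝ H) ν = ⊥ := by
  -- `A` represents the form shifted by `c`. The shift compensates the lower bound of `Q`, so `A` is
  -- coercive with constant `1`, hence invertible.
  let A : V →L[ℝ] V := 1 + J.adjoint ∘L (Q + c • 1) ∘L J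
  have hA : ∀ w z, inner ℝ (A w) z = weakForm J Q w z + c * inner ℝ (J w) (J z) := by
    intro w z
    simp [A, weakForm, inner_add_left, ContinuousLinearMap.adjoint_inner_left,
      real_inner_smul_left, add_assoc]
  have hAs : ∀ w z, inner ℝ (A w) z = inner ℝ w (A z) := by
    intro w z
    rw [hA, real_inner_comm (A z) w, hA z w, weakForm_comm hQ w z, real_inner_comm (J z) (J w)]
  have hAp : ∀ w, ‖w‖ ^ 2 ≤ inner ℝ (A w) w := by
    intro w
    rw [hA, weakForm, real_inner_self_eq_norm_sq, real_inner_self_eq_norm_sq]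
    linarith [hc (J w)]
  have hAu : IsUnit A := by
    refine A.isUnit_of_forall_le_norm_inner_map (c := 1) one_pos fun w => ?_
    rw [NNReal.coe_one, mul_one]
    exact (hAp w).trans (le_abs_self _)
  obtain ⟨U, hU⟩ := hAu
  let B : V →L[ℝ] V := ↑U⁻¹
  have hAB : ∀ y, A (B y) = y := fun y => by
    rw [← hU]; exact congrArg (fun T : V →L[ℝ] V => T y) U.mul_inv
  have hBA : ∀ y, B (A y) = y := fun y => by
    rw [← hU]; exact congrArg (fun T : V →L[ℝ] V => T y) U.inv_mul
  -- The resolvent `J A⁻¹ J*`: the equation `A w = (μ + c) J* J w` becomes `S u = (μ + c)⁻¹ u` for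
  -- `u = J w`.
  let S : H →L[ℝ] H := J ∘L B ∘L J.adjoint
  have hS : ∀ u, S u = J (B (J.adjoint u)) := fun u => rfl
  have key : ∀ μ w, (∀ z, weakForm J Q w z = μ * inner ℝ (J w) (J z)) ↔
      A w = (μ + c) • J.adjoint (J w) := by
    intro μ w
    constructor
    · intro h
      refine ext_inner_right ℝ fun z => ?_
      rw [hA, h, real_inner_smul_left, ContinuousLinearMap.adjoint_inner_left]
      ring
    · intro h z
      have := hA w z
      rw [h, real_inner_smul_left, ContinuousLinearMap.adjoint_inner_left] at this
      linarith
  refine ⟨S, hJ.comp_clm _, fun u v => ?_, fun μ hμ => ?_, fun μ hμ => ?_, fun ν hν => ?_⟩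
  · change inner ℝ (J (B (J.adjoint u))) v = inner ℝ u (J (B (J.adjoint v)))
    rw [← ContinuousLinearMap.adjoint_inner_right J, ← ContinuousLinearMap.adjoint_inner_left J]
    conv_lhs => rw [← hAB (J.adjoint v), ← hAs, hAB]
  · rw [eq_bot_iff]
    rintro _ ⟨w, rfl, hw⟩
    rw [key] at hw
    have h1 := hAp w
    rw [hw, real_inner_smul_left, ContinuousLinearMap.adjoint_inner_left,
      real_inner_self_eq_norm_sq] at h1
    have h2 : (μ + c) * ‖J w‖ ^ 2 ≤ 0 := mul_nonpos_of_nonpos_of_nonneg hμ (sq_nonneg _)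
    have h3 : ‖w‖ = 0 := by
      have := sq_nonneg ‖w‖
      exact pow_eq_zero_iff two_ne_zero |>.1 (by linarith)
    rw [norm_eq_zero.1 h3, map_zero]
    exact Submodule.zero_mem _
  · ext u
    rw [Module.End.mem_eigenspace_iff]
    constructor
    · rintro ⟨w, rfl, hw⟩
      rw [key] at hw
      have h1 : w = (μ + c) • B (J.adjoint (J w)) := by
        rw [← map_smul, ← hw, hBA]
      change J (B (J.adjoint (J w))) = _
      conv_rhs => rw [h1]
      rw [map_smul, smul_smul, inv_mul_cancel₀ hμ.ne', one_smul]
    · intro h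
      change S u = _ at h
      rw [hS] at h
      have h1 : J ((μ + c) • B (J.adjoint u)) = u := by
        rw [map_smul, h, smul_smul, mul_inv_cancel₀ hμ.ne', one_smul]
      refine ⟨(μ + c) • B (J.adjoint u), h1, ?_⟩
      rw [key, h1, map_smul, hAB]
  -- Since `⟪S u, u⟫` dominates `‖B J* u‖²`, an eigenvalue `ν ≤ 0` forces `J* u = 0`; then `u` is
  -- orthogonal to the dense range of `J`.
  · rw [eq_bot_iff]
    intro u hu
    rw [Module.End.mem_eigenspace_iff] at hu
    change S u = _ at hu
    have h1 := hAp (B (J.adjoint u))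
    rw [hAB, ContinuousLinearMap.adjoint_inner_left, ← hS, hu, real_inner_smul_right,
      real_inner_self_eq_norm_sq] at h1
    have h2 : ν * ‖u‖ ^ 2 ≤ 0 := mul_nonpos_of_nonpos_of_nonneg hν (sq_nonneg _)
    have h3 : ‖B (J.adjoint u)‖ = 0 := by
      have := sq_nonneg ‖B (J.adjoint u)‖
      exact pow_eq_zero_iff two_ne_zero |>.1 (by linarith)
    have h4 : J.adjoint u = 0 := by
      rw [← hAB (J.adjoint u), norm_eq_zero.1 h3, map_zero]
    rw [Submodule.mem_bot]
    refine hd.eq_zero_of_inner_left ℝ fun w => ?_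
    rw [← ContinuousLinearMap.adjoint_inner_left, h4, inner_zero_left]

/-- The spectral theorem for the resolvent: only its eigenvalues `ν > 0` contribute, and they
correspond to `μ = ν⁻¹ - c`. -/
theorem orthogonal_iSup_weakEigenspace (hQ : Q.IsSymmetric) (hJ : IsCompactOperator J)
    (hd : DenseRange J) {c : ℝ} (hc : ∀ u, -(c * ‖u‖ ^ 2) ≤ inner ℝ (Q u) u) :
    (⨆ μ, weakEigenspace J Q μ)ᗮ = ⊥ := by
  obtain ⟨S, hS, hSs, -, h2, h3⟩ := exists_compact_resolvent hQ hJ hd hc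
  rw [eq_bot_iff, ← S.orthogonalComplement_iSup_eigenspaces_eq_bot hS hSs]
  refine Submodule.orthogonal_le (iSup_le fun ν => ?_)
  rcases le_or_gt ν 0 with hν | hν
  · rw [h3 ν hν]; exact bot_le
  · have := h2 (ν⁻¹ - c) (by simpa using hν)
    rw [sub_add_cancel, inv_inv] at this
    rw [← this]
    exact le_iSup (fun μ => weakEigenspace J Q μ) _

theorem finiteDimensional_weakEigenspace (hQ : Q.IsSymmetric) (hJ : IsCompactOperator J)
    (hd : DenseRange J) {c : ℝ} (hc : ∀ u, -(c * ‖u‖ ^ 2) ≤ inner ℝ (Q u) u) (μ : ℝ) :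
    FiniteDimensional ℝ (weakEigenspace J Q μ) := by
  obtain ⟨S, hS, hSs, h1, h2, -⟩ := exists_compact_resolvent hQ hJ hd hc
  rcases le_or_gt (μ + c) 0 with h | h
  · rw [h1 μ h]; infer_instance
  · rw [h2 μ h]
    exact S.finite_dimensional_eigenspace hS _ (inv_ne_zero h.ne')

/-- The resolvent multiplies each eigenvector with eigenvalue at most `t` by at least `(t + c)⁻¹`.
Infinitely many such orthonormal vectors would have images at mutual distance at least `(t + c)⁻¹`,
against compactness. -/
theorem Orthonormal.finite_setOf_weakEigenvalue_le (hQ : Q.IsSymmetric)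
    (hJ : IsCompactOperator J)
    (hd : DenseRange J) {c : ℝ} (hc : ∀ u, -(c * ‖u‖ ^ 2) ≤ inner ℝ (Q u) u)
    {ι : Type*} {ψ : ι → H} (hψ : Orthonormal ℝ ψ) {f : ι → ℝ}
    (hf : ∀ i, ψ i ∈ weakEigenspace J Q (f i)) (t : ℝ) : {i | f i ≤ t}.Finite := by
  obtain ⟨S, hS, hSs, h1, h2, -⟩ := exists_compact_resolvent hQ hJ hd hc
  by_contra hinf
  have hinf : {i | f i ≤ t}.Infinite := hinf
  let g := hinf.natEmbedding
  have hpos : ∀ i, 0 < f i + c := by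
    intro i
    by_contra h
    have := hf i
    rw [h1 _ (not_lt.1 h), Submodule.mem_bot] at this
    exact hψ.ne_zero i this
  have hSψ : ∀ i, S (ψ i) = (f i + c)⁻¹ • ψ i := by
    intro i
    have := hf i
    rw [h2 _ (hpos i), Module.End.mem_eigenspace_iff] at this
    exact this
  have hK := hS.isCompact_closure_image_closedBall (1 : ℝ)
  have hmem : ∀ n, S (ψ (g n)) ∈ closure (S '' Metric.closedBall 0 1) := fun n =>
    subset_closure ⟨_, by simp [hψ.1], rfl⟩
  obtain ⟨a, -, r, hr, hlim⟩ := hK.tendsto_subseq hmem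
  have hcau := hlim.cauchySeq
  have htc : 0 < t + c := lt_of_lt_of_le (hpos (g 0)) (by linarith [show f (g 0) ≤ t from (g 0).2])
  obtain ⟨N, hN⟩ := Metric.cauchySeq_iff'.1 hcau (t + c)⁻¹ (inv_pos.2 htc)
  have h3 := hN (N + 1) (Nat.le_succ N)
  have hne : (g (r (N + 1)) : ι) ≠ g (r N) := fun h =>
    (hr (Nat.lt_succ_self N)).ne' (g.injective (Subtype.ext h))
  have hb : ((t + c)⁻¹) ≤ (f (g (r (N + 1))) + c)⁻¹ :=
    inv_anti₀ (hpos _) (by linarith [show f (g (r (N + 1))) ≤ t from (g (r (N + 1))).2])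
  have h4 : inner ℝ (ψ (g (r (N + 1)))) (S (ψ (g (r (N + 1)))) - S (ψ (g (r N)))) =
      (f (g (r (N + 1))) + c)⁻¹ := by
    rw [hSψ, hSψ, inner_sub_right, real_inner_smul_right, real_inner_smul_right,
      real_inner_self_eq_norm_sq, hψ.1, hψ.2 hne]
    ring
  have h5 := (le_abs_self _).trans (abs_real_inner_le_norm (ψ (g (r (N + 1))))
    (S (ψ (g (r (N + 1)))) - S (ψ (g (r N)))))
  rw [h4, hψ.1, one_mul, ← dist_eq_norm] at h5
  exact absurd h3 (not_lt.2 (hb.trans h5))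

end WeakEigenvalueProblem

/-! ### Increasing enumeration of a family with finite sublevel sets -/

section Enumeration

theorem exists_monotone_enumeration {ι : Type*} [Infinite ι] (f : ι → ℝ)
    (h : ∀ t, {i | f i ≤ t}.Finite) : ∃ g : ℕ ≃ ι, Monotone (f ∘ g) := by
  have hc : Countable ι := by
    have h1 : (⋃ n : ℕ, {i | f i ≤ n}) = univ :=
      eq_univ_of_forall fun i => mem_iUnion.2 (exists_nat_ge (f i))
    exact countable_univ_iff.1 (h1 ▸ countable_iUnion fun n => (h n).countable)
  obtain ⟨k, hk⟩ := hc.exists_injective_nat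
  -- Ties of `f` are broken by an injection into `ℕ`. In this linear order all initial segments are
  -- finite and there is no maximum, so it is isomorphic to `ℕ`.
  let key : ι → ℝ ×ₗ ℕ := fun i => toLex (f i, k i)
  have hkey : Function.Injective key := fun i j hij =>
    hk (congrArg (fun p : ℝ ×ₗ ℕ => (ofLex p).2) hij)
  let : LinearOrder ι := LinearOrder.lift' key hkey
  have hmono : Monotone f := fun i j hij => by
    have : key i ≤ key j := hij
    rcases (Prod.Lex.toLex_le_toLex).1 this with h1 | h1
    · exact h1.le
    · exact h1.1.le
  have hfin : ∀ i : ι, (Iic i).Finite := fun i => (h (f i)).subset fun j hj => hmono hj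
  let : LocallyFiniteOrder ι :=
    LocallyFiniteOrder.ofFiniteIcc fun a b => (hfin b).subset Icc_subset_Iic_self
  have : NoMaxOrder ι := ⟨fun a => by
    by_contra! hcon
    exact Set.infinite_univ ((hfin a).subset fun j _ => hcon j)⟩
  obtain ⟨i₀⟩ : Nonempty ι := inferInstance
  obtain ⟨b, hb, hbm⟩ := (hfin i₀).exists_minimal ⟨i₀, mem_Iic.2 le_rfl⟩
  let : OrderBot ι :=
    { bot := b
      bot_le := fun a => by
        rcases le_total a i₀ with h1 | h1
        · rcases le_total a b with h2 | h2
          · exact hbm h1 h2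
          · exact h2
        · exact (show b ≤ i₀ from hb).trans h1 }
  let := LinearLocallyFiniteOrder.succOrder ι
  let := LinearLocallyFiniteOrder.predOrder ι
  let g := (orderIsoNatOfLinearSuccPredArch (ι := ι))
  exact ⟨g.symm.toEquiv, fun a b hab => hmono (g.symm.monotone hab)⟩

end Enumeration

/-! ### Eigenvalue sequences with multiplicity, and eigenbases -/

section Eigenbasis

variable {H : Type*} [NormedAddCommGroup H] [InnerProductSpace ℝ H]
  {E : ℝ → Submodule ℝ H}

/-- The index set consists of pairs of an eigenvalue and a basis vector of its eigenspace. It is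
infinite, since a finite family has closed span and could not be total in `H`. -/
theorem exists_monotone_eigenvalue_seq
    (hE : OrthogonalFamily ℝ (fun μ => E μ) fun μ => (E μ).subtypeₗᵢ)
    (hfd : ∀ μ, FiniteDimensional ℝ (E μ)) (htot : (⨆ μ, E μ)ᗮ = ⊥)
    (hH : ¬ FiniteDimensional ℝ H)
    (hfin : ∀ (ι : Type) (ψ : ι → H) (f : ι → ℝ), Orthonormal ℝ ψ → (∀ i, ψ i ∈ E (f i)) →
      ∀ t, {i | f i ≤ t}.Finite) :
    ∃ ev : ℕ → ℝ, Monotone ev ∧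
      ∀ μ, {k | ev k = μ}.encard = Module.finrank ℝ (E μ) := by
  let ι := Σ μ : ℝ, Fin (Module.finrank ℝ (E μ))
  let ψ : ι → H := fun i => (stdOrthonormalBasis ℝ (E i.1) i.2 : H)
  have hψ : Orthonormal ℝ ψ :=
    hE.orthonormal_sigma_orthonormal fun μ => (stdOrthonormalBasis ℝ (E μ)).orthonormal
  have hle : ∀ μ, E μ ≤ Submodule.span ℝ (range ψ) := by
    intro μ u hu
    have h1 := (stdOrthonormalBasis ℝ (E μ)).sum_repr ⟨u, hu⟩
    have h2 := congrArg (E μ).subtype h1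
    rw [map_sum] at h2
    rw [show u = (E μ).subtype ⟨u, hu⟩ from rfl, ← h2]
    refine Submodule.sum_mem _ fun i _ => ?_
    rw [map_smul]
    exact Submodule.smul_mem _ _ (Submodule.subset_span ⟨⟨μ, i⟩, rfl⟩)
  have hinf : Infinite ι := by
    by_contra hcon
    rw [not_infinite_iff_finite] at hcon
    have : FiniteDimensional ℝ (Submodule.span ℝ (range ψ)) :=
      FiniteDimensional.span_of_finite ℝ (finite_range ψ)
    have h1 : (Submodule.span ℝ (range ψ))ᗮ = ⊥ :=
      eq_bot_iff.2 (htot ▸ Submodule.orthogonal_le (iSup_le hle))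
    rw [Submodule.orthogonal_eq_bot_iff] at h1
    rw [h1] at this
    exact hH (Module.finite_def.2 (Submodule.fg_top _ |>.1 (by
      have := Module.finite_def.1 this
      rwa [Submodule.fg_top] at this ⊢)))
  obtain ⟨g, hg⟩ := exists_monotone_enumeration (fun i : ι => i.1)
    (hfin ι ψ _ hψ fun i => (stdOrthonormalBasis ℝ (E i.1) i.2).2)
  refine ⟨_, hg, fun μ => ?_⟩
  have h1 : {k | ((fun i : ι => i.1) ∘ g) k = μ} =
      g.symm '' range (fun i : Fin (Module.finrank ℝ (E μ)) => (⟨μ, i⟩ : ι)) := by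
    ext k
    rw [Equiv.image_symm_eq_preimage]
    constructor
    · intro hk
      have hk : (g k).1 = μ := hk
      subst hk
      exact ⟨(g k).2, rfl⟩
    · rintro ⟨i, hi⟩
      change (g k).1 = μ
      rw [← hi]
  rw [h1, g.symm.injective.encard_image, ← image_univ, Function.Injective.encard_image,
    encard_univ, ENat.card_eq_coe_fintype_card, Fintype.card_fin]
  intro i j hij
  exact eq_of_heq (Sigma.mk.inj hij).2

/-- For any sequence with the right multiplicities, `{k | ev k = μ}` has as many elements as a basis
of `E μ`, so it can index an orthonormal one. This serves an arbitrary eigenvalue sequence, not just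
the one constructed above. -/
theorem exists_orthonormal_eigenbasis
    (hE : OrthogonalFamily ℝ (fun μ => E μ) fun μ => (E μ).subtypeₗᵢ)
    (hfd : ∀ μ, FiniteDimensional ℝ (E μ)) (htot : (⨆ μ, E μ)ᗮ = ⊥) {ev : ℕ → ℝ}
    (hev : ∀ μ, {k | ev k = μ}.encard = Module.finrank ℝ (E μ)) :
    ∃ ψ : ℕ → H, Orthonormal ℝ ψ ∧ (∀ k, ψ k ∈ E (ev k)) ∧
      (Submodule.span ℝ (range ψ))ᗮ = ⊥ := by
  have hb : ∀ μ, ∃ b : {k | ev k = μ} → E μ, Orthonormal ℝ b ∧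
      Submodule.span ℝ (range b) = ⊤ := by
    intro μ
    have hf : {k | ev k = μ}.Finite := by
      rw [← encard_lt_top_iff, hev]
      exact ENat.natCast_lt_top _
    let := hf.fintype
    have e : Fin (Module.finrank ℝ (E μ)) ≃ {k | ev k = μ} := by
      refine (Fintype.equivFinOfCardEq ?_).symm
      have := hev μ
      rw [← coe_fintypeCard] at this
      exact_mod_cast this
    let b := (stdOrthonormalBasis ℝ (E μ)).reindex e
    refine ⟨b, b.orthonormal, ?_⟩
    rw [← b.coe_toBasis, b.toBasis.span_eq]
  choose b hbo hbs using hb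
  have hcongr : ∀ (k : ℕ) (μ : ℝ) (h : ev k = μ),
      ((b (ev k) ⟨k, rfl⟩ : E (ev k)) : H) = (b μ ⟨k, h⟩ : H) := by
    rintro k _ rfl; rfl
  refine ⟨fun k => (b (ev k) ⟨k, rfl⟩ : H), ⟨fun k => (hbo (ev k)).1 _, fun k l hkl => ?_⟩,
    fun k => (b (ev k) ⟨k, rfl⟩).2, ?_⟩
  · change inner ℝ (b (ev k) ⟨k, rfl⟩ : H) (b (ev l) ⟨l, rfl⟩ : H) = 0
    by_cases h : ev k = ev l
    · rw [hcongr k (ev l) h]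
      exact (hbo (ev l)).2 fun h => hkl (congrArg Subtype.val h)
    · exact hE h _ _
  · refine eq_bot_iff.2 (htot ▸ Submodule.orthogonal_le (iSup_le fun μ => ?_))
    have h1 := congrArg (Submodule.map (E μ).subtype) (hbs μ)
    rw [Submodule.map_subtype_top, Submodule.map_span] at h1
    rw [← h1]
    refine Submodule.span_mono ?_
    rintro _ ⟨_, ⟨⟨k, hk⟩, rfl⟩, rfl⟩
    exact ⟨k, hcongr k μ hk⟩

end Eigenbasis

/-! ### Ky Fan's inequality and its equality case -/

section VariationalPrinciple

variable {V H : Type*} [NormedAddCommGroup V] [InnerProductSpace ℝ V]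
  [NormedAddCommGroup H] [InnerProductSpace ℝ H] {J : V →L[ℝ] H} {Q : H →L[ℝ] H}

theorem weakForm_sum_left {ι : Type*} (s : Finset ι) (w : ι → V) (z : V) :
    weakForm J Q (∑ i ∈ s, w i) z = ∑ i ∈ s, weakForm J Q (w i) z := by
  simp only [weakForm, map_sum, sum_inner, Finset.sum_add_distrib]

theorem weakForm_sub_self (hQ : Q.IsSymmetric) (w s : V) : weakForm J Q (w - s) (w - s) =
    weakForm J Q w w - 2 * weakForm J Q s w + weakForm J Q s s := by
  have h := weakForm_comm (J := J) hQ w s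
  simp only [weakForm, map_sub, inner_sub_left, inner_sub_right] at *
  linarith

/-- **Bessel's inequality** for a nonnegative form and eigenvectors. -/
theorem sum_weakEigenvalue_mul_inner_sq_le (hQ : Q.IsSymmetric)
    (hnn : ∀ w, 0 ≤ weakForm J Q w w) {ι : Type*} {ψ : ι → H} (hψ : Orthonormal ℝ ψ) {σ : ι → ℝ}
    (hmem : ∀ k, ψ k ∈ weakEigenspace J Q (σ k)) (s : Finset ι) (w : V) :
    ∑ i ∈ s, σ i * inner ℝ (ψ i) (J w) ^ 2 ≤ weakForm J Q w w := by
  choose y hy hyw using hmem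
  have h1 : ∀ z, weakForm J Q (∑ i ∈ s, inner ℝ (ψ i) (J w) • y i) z =
      ∑ i ∈ s, inner ℝ (ψ i) (J w) * (σ i * inner ℝ (ψ i) (J z)) := by
    intro z
    rw [weakForm_sum_left]
    refine Finset.sum_congr rfl fun i _ => ?_
    rw [weakForm_smul_left, hyw, hy]
  have h2 : ∀ i ∈ s, inner ℝ (ψ i) (J (∑ i ∈ s, inner ℝ (ψ i) (J w) • y i)) =
      inner ℝ (ψ i) (J w) := by
    intro i hi
    simp only [map_sum, map_smul, hy]
    exact hψ.inner_right_sum _ hi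
  -- Nonnegativity at `w` minus its eigenvector part; `y i` lifts `ψ i` to `V`.
  have h3 := hnn (w - ∑ i ∈ s, inner ℝ (ψ i) (J w) • y i)
  have h4 : ∑ i ∈ s, inner ℝ (ψ i) (J w) * (σ i * inner ℝ (ψ i) (J w)) =
      ∑ i ∈ s, σ i * inner ℝ (ψ i) (J w) ^ 2 := Finset.sum_congr rfl fun i _ => by ring
  have h5 : ∑ i ∈ s, inner ℝ (ψ i) (J w) * (σ i * inner ℝ (ψ i)
      (J (∑ i ∈ s, inner ℝ (ψ i) (J w) • y i))) = ∑ i ∈ s, σ i * inner ℝ (ψ i) (J w) ^ 2 :=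
    Finset.sum_congr rfl fun i hi => by rw [h2 i hi]; ring
  rw [weakForm_sub_self hQ, h1, h1, h4, h5] at h3
  linarith

variable [CompleteSpace H] {ψ : ℕ → H} {σ : ℕ → ℝ}

/-- Bessel's inequality with `N ≥ n` terms, where `σ k` is lowered to `τ` for `k ≥ n`; then `N → ∞`
by Parseval. -/
theorem add_sum_mul_inner_sq_le_weakForm (hQ : Q.IsSymmetric) (hnn : ∀ w, 0 ≤ weakForm J Q w w)
    (hψ : Orthonormal ℝ ψ) (htot : (Submodule.span ℝ (range ψ))ᗮ = ⊥)
    (hmem : ∀ k, ψ k ∈ weakEigenspace J Q (σ k)) {n : ℕ} {τ : ℝ} (hτ : ∀ k, n ≤ k → τ ≤ σ k)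
    (w : V) : τ * ‖J w‖ ^ 2 + ∑ k ∈ Finset.range n, (σ k - τ) * inner ℝ (ψ k) (J w) ^ 2 ≤
      weakForm J Q w w := by
  let b := HilbertBasis.mkOfOrthogonalEqBot hψ htot
  have hb : ∀ k, b k = ψ k := fun k => congrFun (HilbertBasis.coe_mkOfOrthogonalEqBot hψ htot) k
  have h1 := (b.hasSum_inner_mul_inner (J w) (J w)).tendsto_sum_nat
  simp only [hb, real_inner_self_eq_norm_sq, real_inner_comm, ← sq] at h1
  have h2 := (h1.const_mul τ).add_const
    (∑ k ∈ Finset.range n, (σ k - τ) * inner ℝ (ψ k) (J w) ^ 2)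
  refine le_of_tendsto h2 (eventually_atTop.2 ⟨n, fun N hN => ?_⟩)
  refine le_trans ?_ (sum_weakEigenvalue_mul_inner_sq_le hQ hnn hψ hmem (Finset.range N) w)
  have h3 : ∑ k ∈ Finset.range n, (σ k - τ) * inner ℝ (ψ k) (J w) ^ 2 ≤
      ∑ k ∈ Finset.range N, (σ k - τ) * inner ℝ (ψ k) (J w) ^ 2 := by
    refine Finset.sum_le_sum_of_subset_of_nonneg (Finset.range_mono hN) fun k _ hk => ?_
    rw [Finset.mem_range, not_lt] at hk
    exact mul_nonneg (sub_nonneg.2 (hτ k hk)) (sq_nonneg _)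
  refine (add_le_add_right h3 _).trans (le_of_eq ?_)
  rw [Finset.mul_sum, ← Finset.sum_add_distrib]
  exact Finset.sum_congr rfl fun k _ => by ring

theorem sum_weakEigenvalue_le_of_nonneg (hQ : Q.IsSymmetric) (hnn : ∀ w, 0 ≤ weakForm J Q w w)
    (hψ : Orthonormal ℝ ψ) (htot : (Submodule.span ℝ (range ψ))ᗮ = ⊥)
    (hmem : ∀ k, ψ k ∈ weakEigenspace J Q (σ k)) (hσ : Monotone σ) {n : ℕ} {φ : Fin n → V}
    (hφ : Orthonormal ℝ fun i => J (φ i)) :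
    ∑ k ∈ Finset.range n, σ k ≤ ∑ i, weakForm J Q (φ i) (φ i) := by
  -- With `τ` the `n`-th eigenvalue, the weights `σ k - τ` for `k < n` are nonpositive, and Bessel
  -- bounds each `∑ i, ⟪ψ k, J (φ i)⟫²` by `1`. For `n = 0` the truncated index is harmless.
  have h1 := Finset.sum_le_sum fun (i : Fin n) (_ : i ∈ Finset.univ) =>
    add_sum_mul_inner_sq_le_weakForm hQ hnn hψ htot hmem (n := n) (τ := σ (n - 1))
      (fun k hk => hσ (by omega)) (φ i)
  refine le_trans ?_ h1
  rw [Finset.sum_add_distrib, Finset.sum_comm]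
  have h2 : ∀ k ∈ Finset.range n, σ k - σ (n - 1) ≤
      ∑ i : Fin n, (σ k - σ (n - 1)) * inner ℝ (ψ k) (J (φ i)) ^ 2 := by
    intro k hk
    have h3 : ∑ i : Fin n, inner ℝ (ψ k) (J (φ i)) ^ 2 ≤ 1 := by
      have := hφ.sum_inner_products_le (ψ k) (s := Finset.univ)
      simpa only [Real.norm_eq_abs, sq_abs, hψ.1, one_pow, real_inner_comm] using this
    have h4 : σ k ≤ σ (n - 1) := hσ (by have := Finset.mem_range.1 hk; omega)
    rw [← Finset.mul_sum]
    nlinarith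
  have h5 := Finset.sum_le_sum h2
  simp only [hφ.1, one_pow, mul_one, Finset.sum_const, Finset.card_univ, Fintype.card_fin]
  rw [Finset.sum_sub_distrib, Finset.sum_const, Finset.card_range] at h5
  linarith

/-- **Ky Fan's inequality**: the sum of the first `n` eigenvalues is at most the sum of the form
over any `n` vectors that are orthonormal in `H`. -/
theorem sum_weakEigenvalue_le (hQ : Q.IsSymmetric) {c : ℝ}
    (hc : ∀ u, -(c * ‖u‖ ^ 2) ≤ inner ℝ (Q u) u)
    (hψ : Orthonormal ℝ ψ) (htot : (Submodule.span ℝ (range ψ))ᗮ = ⊥)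
    (hmem : ∀ k, ψ k ∈ weakEigenspace J Q (σ k)) (hσ : Monotone σ) {n : ℕ} {φ : Fin n → V}
    (hφ : Orthonormal ℝ fun i => J (φ i)) :
    ∑ k ∈ Finset.range n, σ k ≤ ∑ i, weakForm J Q (φ i) (φ i) := by
  have hshift : ∀ w z, weakForm J (Q + c • 1) w z = weakForm J Q w z + c * inner ℝ (J w) (J z) := by
    intro w z
    simp [weakForm, inner_add_left, real_inner_smul_left, add_assoc]
  have hQ' : (Q + c • (1 : H →L[ℝ] H)).IsSymmetric := by
    intro u v
    have h : inner ℝ (Q u) v = inner ℝ u (Q v) := hQ u v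
    simp [inner_add_left, inner_add_right, real_inner_smul_left, real_inner_smul_right, h]
  -- Shifting by `c` makes the form nonnegative and adds `n c` to both sides.
  have h1 := sum_weakEigenvalue_le_of_nonneg (J := J) (σ := fun k => σ k + c) hQ' (fun w => ?_) hψ
    htot (fun k => ?_) (fun i j hij => add_le_add_left (hσ hij) c) hφ
  · simp only [hshift, real_inner_self_eq_norm_sq, hφ.1, Finset.sum_add_distrib, Finset.sum_const,
      Finset.card_univ, Fintype.card_fin, Finset.card_range, one_pow, mul_one] at h1
    linarith
  · rw [hshift, weakForm, real_inner_self_eq_norm_sq, real_inner_self_eq_norm_sq]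
    linarith [hc (J w), sq_nonneg ‖w‖]
  · obtain ⟨w, hw, hw'⟩ := hmem k
    exact ⟨w, hw, fun z => by rw [hshift, hw' z]; ring⟩

/-- If equality holds in Ky Fan's inequality for the first `n` members of a sequence that is
orthonormal in `H`, then the form vanishes between these and the other members. -/
theorem weakForm_eq_zero_of_sum_weakEigenvalue_eq (hQ : Q.IsSymmetric) {c : ℝ}
    (hc : ∀ u, -(c * ‖u‖ ^ 2) ≤ inner ℝ (Q u) u)
    (hψ : Orthonormal ℝ ψ) (htot : (Submodule.span ℝ (range ψ))ᗮ = ⊥)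
    (hmem : ∀ k, ψ k ∈ weakEigenspace J Q (σ k)) (hσ : Monotone σ) {n : ℕ} {e : ℕ → V}
    (he : Orthonormal ℝ fun i => J (e i))
    (heq : ∑ k ∈ Finset.range n, σ k = ∑ k ∈ Finset.range n, weakForm J Q (e k) (e k))
    {k j : ℕ} (hk : k < n) (hj : n ≤ j) : weakForm J Q (e k) (e j) = 0 := by
  have hkj : k ≠ j := by omega
  -- Replace `e k` by the normalised `e k + t • e j`. As `j ≥ n`, the first `n` vectors stay
  -- orthonormal in `H`, and Ky Fan's inequality says that their sum has not decreased.
  have key : ∀ t : ℝ, 0 ≤ 2 * t * weakForm J Q (e k) (e j) +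
      t ^ 2 * (weakForm J Q (e j) (e j) - weakForm J Q (e k) (e k)) := by
    intro t
    let r : ℝ := (√(1 + t ^ 2))⁻¹
    have hr : r ^ 2 * (1 + t ^ 2) = 1 := by
      have : (0 : ℝ) < 1 + t ^ 2 := by positivity
      rw [inv_pow, Real.sq_sqrt this.le, inv_mul_cancel₀ this.ne']
    let x : V := r • (e k + t • e j)
    have hx : weakForm J Q x x = r ^ 2 * (weakForm J Q (e k) (e k) +
        2 * t * weakForm J Q (e k) (e j) + t ^ 2 * weakForm J Q (e j) (e j)) := by
      simp only [x, weakForm_smul_left, weakForm_smul_right, weakForm_add_left, weakForm_add_right,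
        weakForm_comm hQ (e j) (e k)]
      ring
    have hJx : J x = r • (J (e k) + t • J (e j)) := by simp only [x, map_smul, map_add]
    have hxn : inner ℝ (J x) (J x) = 1 := by
      have hself : ∀ i, inner ℝ (J (e i)) (J (e i)) = 1 := fun i => by
        rw [real_inner_self_eq_norm_sq, he.1, one_pow]
      simp only [hJx, real_inner_smul_left, real_inner_smul_right, inner_add_left, inner_add_right,
        hself, he.2 hkj, he.2 hkj.symm]
      linarith
    have hxo : ∀ l, l ≠ k → l ≠ j → inner ℝ (J x) (J (e l)) = 0 := by
      intro l h1 h2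
      simp only [hJx, real_inner_smul_left, inner_add_left, he.2 h1.symm, he.2 h2.symm]
      ring
    have hφ : Orthonormal ℝ fun i : Fin n => J (Function.update e k x i) := by
      constructor
      · intro i
        dsimp only
        by_cases h : (i : ℕ) = k
        · rw [h, Function.update_self, ← sq_eq_sq₀ (norm_nonneg _) zero_le_one,
            ← real_inner_self_eq_norm_sq, hxn, one_pow]
        · rw [Function.update_of_ne h]
          exact he.1 _
      · intro i l hil
        have hil' : (i : ℕ) ≠ l := fun h => hil (Fin.ext h)
        have hi := i.2
        have hl := l.2
        dsimp only
        by_cases h : (i : ℕ) = k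
        · rw [h, Function.update_self, Function.update_of_ne (by omega)]
          exact hxo _ (by omega) (by omega)
        · rw [Function.update_of_ne h]
          by_cases h' : (l : ℕ) = k
          · rw [h', Function.update_self, real_inner_comm]
            exact hxo _ (by omega) (by omega)
          · rw [Function.update_of_ne h']
            exact he.2 hil'
    have h1 := sum_weakEigenvalue_le hQ hc hψ htot hmem hσ hφ
    have hsum : ∑ i ∈ (Finset.range n).erase k,
        weakForm J Q (Function.update e k x i) (Function.update e k x i) =
        ∑ i ∈ (Finset.range n).erase k, weakForm J Q (e i) (e i) :=
      Finset.sum_congr rfl fun i hi => by rw [Function.update_of_ne (Finset.ne_of_mem_erase hi)]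
    rw [heq, Fin.sum_univ_eq_sum_range
      (fun i => weakForm J Q (Function.update e k x i) (Function.update e k x i)) n,
      ← Finset.add_sum_erase _ _ (Finset.mem_range.2 hk),
      ← Finset.add_sum_erase _ _ (Finset.mem_range.2 hk), Function.update_self,
      hsum, hx] at h1
    have h2 : weakForm J Q (e k) (e k) ≤ r ^ 2 * (weakForm J Q (e k) (e k) +
        2 * t * weakForm J Q (e k) (e j) + t ^ 2 * weakForm J Q (e j) (e j)) := by linarith
    have h3 := mul_le_mul_of_nonneg_right h2 (by positivity : (0 : ℝ) ≤ 1 + t ^ 2)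
    have h4 : r ^ 2 * (weakForm J Q (e k) (e k) +
        2 * t * weakForm J Q (e k) (e j) + t ^ 2 * weakForm J Q (e j) (e j)) * (1 + t ^ 2) =
        weakForm J Q (e k) (e k) +
        2 * t * weakForm J Q (e k) (e j) + t ^ 2 * weakForm J Q (e j) (e j) := by
      linear_combination (weakForm J Q (e k) (e k) +
        2 * t * weakForm J Q (e k) (e j) + t ^ 2 * weakForm J Q (e j) (e j)) * hr
    rw [h4] at h3
    linarith
  set a := weakForm J Q (e k) (e j)
  set d := weakForm J Q (e j) (e j) - weakForm J Q (e k) (e k)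
  by_contra ha
  -- A small `t` of sign opposite to `a`; the `+ 1` keeps the denominator positive, and the linear
  -- term beats the quadratic one.
  have h1 := key (-a / (|d| + 1))
  have hd : 0 < |d| + 1 := by positivity
  have h2 : 2 * (-a / (|d| + 1)) * a + (-a / (|d| + 1)) ^ 2 * d =
      a ^ 2 / (|d| + 1) ^ 2 * (d - 2 * (|d| + 1)) := by
    field_simp
    ring
  rw [h2] at h1
  have h3 : 0 < a ^ 2 / (|d| + 1) ^ 2 := by positivity
  have h4 : d - 2 * (|d| + 1) < 0 := by linarith [le_abs_self d, abs_nonneg d]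
  exact absurd h1 (not_le.2 (mul_neg_of_pos_of_neg h3 h4))

end VariationalPrinciple

/-! ### Continuous functions as elements of `L²(0, π)` -/

section IntervalLebesgue

theorem integral_intervalMeasure (f : ℝ → ℝ) :
    ∫ x, f x ∂intervalMeasure = ∫ x in (0 : ℝ)..Real.pi, f x := by
  rw [intervalIntegral.integral_of_le Real.pi_pos.le, integral_Ioc_eq_integral_Ioo]

theorem ae_intervalMeasure_of_forall_mem {p : ℝ → Prop} (h : ∀ x ∈ Ioo 0 Real.pi, p x) :
    ∀ᵐ x ∂intervalMeasure, p x :=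
  (ae_restrict_iff' measurableSet_Ioo).2 (ae_of_all _ h)

theorem Continuous.exists_ae_norm_le_intervalMeasure {f : ℝ → ℝ} (hf : Continuous f) :
    ∃ C, ∀ᵐ x ∂intervalMeasure, ‖f x‖ ≤ C := by
  obtain ⟨C, hC⟩ := isCompact_Icc.exists_bound_of_continuousOn (s := Icc 0 Real.pi) hf.continuousOn
  exact ⟨C, ae_intervalMeasure_of_forall_mem fun x hx => hC x (Ioo_subset_Icc_self hx)⟩

theorem Continuous.memLp_intervalMeasure {f : ℝ → ℝ} (hf : Continuous f) (p : ENNReal) :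
    MemLp f p intervalMeasure := by
  obtain ⟨C, hC⟩ := hf.exists_ae_norm_le_intervalMeasure
  exact MemLp.of_bound hf.aestronglyMeasurable C hC

/-- The class in `L²(0, π)` of a continuous function. -/
noncomputable def continuousToL2 (f : C(ℝ, ℝ)) : IntervalL2 :=
  (f.continuous.memLp_intervalMeasure 2).toLp f

theorem coeFn_continuousToL2 (f : C(ℝ, ℝ)) : continuousToL2 f =ᵐ[intervalMeasure] f :=
  MemLp.coeFn_toLp _

theorem inner_intervalL2 (u v : IntervalL2) :
    inner ℝ u v = ∫ x, u x * v x ∂intervalMeasure := by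
  rw [L2.inner_def]
  exact integral_congr_ae (ae_of_all _ fun x => mul_comm _ _)

theorem integrable_mul_intervalL2 (u v : IntervalL2) :
    Integrable (fun x => u x * v x) intervalMeasure :=
  (Lp.memLp u).integrable_mul (Lp.memLp v)

theorem integrable_continuous_mul_intervalL2 {f : ℝ → ℝ} (hf : Continuous f) (u : IntervalL2) :
    Integrable (fun x => f x * u x) intervalMeasure :=
  (hf.memLp_intervalMeasure 2).integrable_mul (Lp.memLp u)

theorem inner_continuousToL2_left (f : C(ℝ, ℝ)) (u : IntervalL2) :
    inner ℝ (continuousToL2 f) u = ∫ x, f x * u x ∂intervalMeasure := by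
  rw [inner_intervalL2]
  refine integral_congr_ae ?_
  filter_upwards [coeFn_continuousToL2 f] with x hx
  rw [hx]

theorem inner_continuousToL2 (f g : C(ℝ, ℝ)) :
    inner ℝ (continuousToL2 f) (continuousToL2 g) = ∫ x in (0 : ℝ)..Real.pi, f x * g x := by
  rw [inner_continuousToL2_left, ← integral_intervalMeasure]
  refine integral_congr_ae ?_
  filter_upwards [coeFn_continuousToL2 g] with x hx
  rw [hx]

end IntervalLebesgue

/-! ### Orthogonality and completeness of the sines -/

section TrigonometricBasis

theorem integral_cos_int_mul (k : ℤ) :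
    ∫ x in (0 : ℝ)..Real.pi, Real.cos (k * x) = if k = 0 then Real.pi else 0 := by
  split_ifs with h
  · simp [h]
  · have hk : (k : ℝ) ≠ 0 := Int.cast_ne_zero.2 h
    rw [intervalIntegral.integral_comp_mul_left _ hk, integral_cos, Real.sin_int_mul_pi]
    simp

theorem Real.sin_mul_sin_eq (a b : ℝ) :
    Real.sin a * Real.sin b = (Real.cos (a - b) - Real.cos (a + b)) / 2 := by
  rw [Real.cos_sub, Real.cos_add]; ring

theorem Real.cos_mul_cos_eq (a b : ℝ) :
    Real.cos a * Real.cos b = (Real.cos (a - b) + Real.cos (a + b)) / 2 := by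
  rw [Real.cos_sub, Real.cos_add]; ring

/-- The class of `sin (m x)` in `L²(0, π)`. -/
noncomputable def sinL2 (m : ℕ) : IntervalL2 :=
  continuousToL2 ⟨fun x => Real.sin (m * x), by fun_prop⟩

/-- The class of `cos (m x)` in `L²(0, π)`. -/
noncomputable def cosL2 (m : ℕ) : IntervalL2 :=
  continuousToL2 ⟨fun x => Real.cos (m * x), by fun_prop⟩

theorem coeFn_sinL2 (m : ℕ) : sinL2 m =ᵐ[intervalMeasure] fun x => Real.sin (m * x) :=
  coeFn_continuousToL2 _

theorem inner_sinL2_sinL2 {m n : ℕ} (hm : m ≠ 0) :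
    inner ℝ (sinL2 m) (sinL2 n) = if m = n then Real.pi / 2 else 0 := by
  have h1 : ∀ k : ℤ, IntervalIntegrable (fun x => Real.cos (k * x)) volume 0 Real.pi := fun k =>
    Continuous.intervalIntegrable (by fun_prop) _ _
  have h : ∀ x : ℝ, Real.sin (m * x) * Real.sin (n * x) =
      (Real.cos (((m - n : ℤ) : ℝ) * x) - Real.cos (((m + n : ℤ) : ℝ) * x)) / 2 := by
    intro x
    rw [Real.sin_mul_sin_eq]
    push_cast
    ring_nf
  rw [sinL2, sinL2, inner_continuousToL2]
  simp only [ContinuousMap.coe_mk, h]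
  rw [intervalIntegral.integral_div, intervalIntegral.integral_sub (h1 _) (h1 _),
    integral_cos_int_mul, integral_cos_int_mul, if_neg (c := (m + n : ℤ) = 0) (by omega)]
  by_cases hmn : m = n
  · simp [hmn]
  · rw [if_neg (by omega), if_neg hmn]; simp

theorem inner_cosL2_cosL2 {m n : ℕ} (hm : m ≠ 0) :
    inner ℝ (cosL2 m) (cosL2 n) = if m = n then Real.pi / 2 else 0 := by
  have h1 : ∀ k : ℤ, IntervalIntegrable (fun x => Real.cos (k * x)) volume 0 Real.pi := fun k =>
    Continuous.intervalIntegrable (by fun_prop) _ _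
  have h : ∀ x : ℝ, Real.cos (m * x) * Real.cos (n * x) =
      (Real.cos (((m - n : ℤ) : ℝ) * x) + Real.cos (((m + n : ℤ) : ℝ) * x)) / 2 := by
    intro x
    rw [Real.cos_mul_cos_eq]
    push_cast
    ring_nf
  rw [cosL2, cosL2, inner_continuousToL2]
  simp only [ContinuousMap.coe_mk, h]
  rw [intervalIntegral.integral_div, intervalIntegral.integral_add (h1 _) (h1 _),
    integral_cos_int_mul, integral_cos_int_mul, if_neg (c := (m + n : ℤ) = 0) (by omega)]
  by_cases hmn : m = n
  · simp [hmn]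
  · rw [if_neg (by omega), if_neg hmn]; simp

/-- The normalising factor `√(2 / π)`. -/
noncomputable def trigNormalizer : ℝ := √(2 / Real.pi)

theorem trigNormalizer_sq : trigNormalizer ^ 2 = 2 / Real.pi :=
  Real.sq_sqrt (by positivity)

theorem trigNormalizer_ne_zero : trigNormalizer ≠ 0 :=
  (Real.sqrt_pos.2 (by positivity)).ne'

theorem orthonormal_smul_of_inner_eq {e : ℕ → IntervalL2}
    (h : ∀ k l, inner ℝ (e k) (e l) = if k = l then Real.pi / 2 else 0) :
    Orthonormal ℝ fun k => trigNormalizer • e k := by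
  rw [orthonormal_iff_ite]
  intro k l
  rw [real_inner_smul_left, real_inner_smul_right, h, ← mul_assoc, ← sq, trigNormalizer_sq]
  split_ifs
  · field_simp
  · simp

theorem orthonormal_sinL2 : Orthonormal ℝ fun k : ℕ => trigNormalizer • sinL2 (k + 1) :=
  orthonormal_smul_of_inner_eq fun k l => by
    rw [inner_sinL2_sinL2 k.succ_ne_zero]; simp

theorem orthonormal_cosL2 : Orthonormal ℝ fun k : ℕ => trigNormalizer • cosL2 (k + 1) :=
  orthonormal_smul_of_inner_eq fun k l => by
    rw [inner_cosL2_cosL2 k.succ_ne_zero]; simp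

/-- Induction by `2 cos x sin kx = sin (k+1)x + sin (k-1)x`; integer `k` allows the frequency to
drop below zero. -/
theorem integral_cos_pow_mul_sin_eq_zero {f : IntervalL2}
    (hf : ∀ k : ℕ, inner ℝ (sinL2 (k + 1)) f = 0) (m : ℕ) (k : ℤ) :
    ∫ x, Real.cos x ^ m * Real.sin (k * x) * f x ∂intervalMeasure = 0 := by
  induction m generalizing k with
  | zero =>
    have h0 : ∀ j : ℕ, ∫ x, Real.sin (j * x) * f x ∂intervalMeasure = 0 := by
      intro j
      rcases j with _ | j
      · simp
      · have := hf j
        rwa [sinL2, inner_continuousToL2_left] at this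
    simp only [pow_zero, one_mul]
    obtain ⟨j, rfl | rfl⟩ := k.eq_nat_or_neg
    · simpa using h0 j
    · have := h0 j
      simp only [Int.cast_neg, Int.cast_natCast, neg_mul, Real.sin_neg, integral_neg, this, neg_zero]
  | succ m ih =>
    have h1 : ∀ x : ℝ, Real.cos x ^ (m + 1) * Real.sin (k * x) * f x =
        2⁻¹ * (Real.cos x ^ m * Real.sin (((k + 1 : ℤ) : ℝ) * x) * f x +
          Real.cos x ^ m * Real.sin (((k - 1 : ℤ) : ℝ) * x) * f x) := by
      intro x
      push_cast
      rw [add_mul, sub_mul, one_mul, Real.sin_add, Real.sin_sub]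
      ring
    have h2 : ∀ j : ℤ, Integrable (fun x => Real.cos x ^ m * Real.sin (j * x) * f x)
        intervalMeasure := fun j => integrable_continuous_mul_intervalL2 (by fun_prop) f
    simp only [h1]
    rw [integral_const_mul, integral_add (h2 _) (h2 _), ih, ih]
    simp

theorem integral_continuous_mul_sin_eq_zero {f : IntervalL2}
    (hf : ∀ k : ℕ, inner ℝ (sinL2 (k + 1)) f = 0) {h : ℝ → ℝ} (hh : Continuous h) :
    ∫ x, h x * (Real.sin x * f x) ∂intervalMeasure = 0 := by
  have hpoly : ∀ p : Polynomial ℝ,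
      ∫ x, p.eval (Real.cos x) * (Real.sin x * f x) ∂intervalMeasure = 0 := by
    intro p
    have hint : ∀ p : Polynomial ℝ, Integrable
        (fun x => p.eval (Real.cos x) * (Real.sin x * f x)) intervalMeasure := by
      intro p
      simp only [← mul_assoc]
      exact integrable_continuous_mul_intervalL2
        ((p.continuous.comp Real.continuous_cos).mul Real.continuous_sin) f
    induction p using Polynomial.induction_on' with
    | add p r hp hr =>
      simp only [Polynomial.eval_add, add_mul]
      rw [integral_add (hint p) (hint r), hp, hr, add_zero]
    | monomial m a =>
      have := integral_cos_pow_mul_sin_eq_zero hf m 1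
      simp only [Polynomial.eval_monomial, mul_assoc] at this ⊢
      rw [integral_const_mul]
      simp only [Int.cast_one, one_mul] at this
      rw [this, mul_zero]
  have hfi : Integrable (fun x => Real.sin x * f x) intervalMeasure :=
    integrable_continuous_mul_intervalL2 Real.continuous_sin f
  by_contra hne
  set a := ∫ x, h x * (Real.sin x * f x) ∂intervalMeasure
  set C := ∫ x, |Real.sin x * f x| ∂intervalMeasure
  have hC : 0 ≤ C := integral_nonneg fun x => abs_nonneg _
  have ha : 0 < |a| := abs_pos.2 hne
  -- Weierstrass in the variable `y = cos x`, which turns `h` on `[0, π]` into a continuous function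
  -- on `[-1, 1]`.
  obtain ⟨p, hp⟩ := exists_polynomial_near_of_continuousOn (-1) 1 (fun y => h (Real.arccos y))
    (hh.comp Real.continuous_arccos).continuousOn (|a| / (C + 1)) (by positivity)
  have h1 : a = ∫ x, (h x - p.eval (Real.cos x)) * (Real.sin x * f x) ∂intervalMeasure := by
    simp only [sub_mul]
    rw [integral_sub, hpoly, sub_zero]
    · simp only [← mul_assoc]
      exact integrable_continuous_mul_intervalL2 (hh.mul Real.continuous_sin) f
    · simp only [← mul_assoc]
      exact integrable_continuous_mul_intervalL2
        ((p.continuous.comp Real.continuous_cos).mul Real.continuous_sin) f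
  have h2 : |a| ≤ |a| / (C + 1) * C := by
    rw [← integral_const_mul]
    conv_lhs => rw [h1]
    refine abs_integral_le_integral_abs.trans ?_
    refine integral_mono_of_nonneg (ae_of_all _ fun x => abs_nonneg _) (hfi.abs.const_mul _)
      (ae_intervalMeasure_of_forall_mem fun x hx => ?_)
    dsimp only
    rw [abs_mul]
    refine mul_le_mul_of_nonneg_right ?_ (abs_nonneg _)
    have := hp (Real.cos x) ⟨Real.neg_one_le_cos x, Real.cos_le_one x⟩
    rw [Real.arccos_cos hx.1.le hx.2.le, abs_sub_comm] at this
    exact this.le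
  have h3 : |a| / (C + 1) * C < |a| := by
    rw [div_mul_eq_mul_div, div_lt_iff₀ (by positivity)]
    nlinarith
  linarith

/-- The product `sin · f` annihilates all test functions, so it vanishes almost everywhere, and
`sin` is positive on `(0, π)`. -/
theorem eq_zero_of_inner_sinL2_eq_zero {f : IntervalL2}
    (hf : ∀ k : ℕ, inner ℝ (sinL2 (k + 1)) f = 0) : f = 0 := by
  have hfi : Integrable (fun x => Real.sin x * f x) intervalMeasure :=
    integrable_continuous_mul_intervalL2 Real.continuous_sin f
  have h1 : ∀ᵐ x ∂(volume : Measure ℝ), x ∈ Ioo 0 Real.pi → Real.sin x * f x = 0 := by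
    refine isOpen_Ioo.ae_eq_zero_of_integral_contDiff_smul_eq_zero
      (IntegrableOn.locallyIntegrableOn hfi) fun g hg _ hgs => ?_
    have h2 := integral_continuous_mul_sin_eq_zero hf hg.continuous
    rw [setIntegral_eq_integral_of_forall_compl_eq_zero] at h2
    · exact h2
    · intro x hx
      rw [image_eq_zero_of_notMem_tsupport fun h => hx (hgs h), zero_mul]
  refine Lp.eq_zero_iff_ae_eq_zero.2 ?_
  rw [EventuallyEq, ae_restrict_iff' measurableSet_Ioo]
  filter_upwards [h1] with x hx hx'
  exact (mul_eq_zero.1 (hx hx')).resolve_left (Real.sin_pos_of_pos_of_lt_pi hx'.1 hx'.2).ne'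

theorem orthogonal_span_sinL2 :
    (Submodule.span ℝ (range fun k : ℕ => trigNormalizer • sinL2 (k + 1)))ᗮ = ⊥ := by
  refine eq_bot_iff.2 fun f hf => ?_
  rw [Submodule.mem_orthogonal] at hf
  refine eq_zero_of_inner_sinL2_eq_zero fun k => ?_
  have := hf _ (Submodule.subset_span ⟨k, rfl⟩)
  rw [real_inner_smul_left] at this
  exact (mul_eq_zero.1 this).resolve_left trigNormalizer_ne_zero

end TrigonometricBasis

/-! ### A compactness criterion through decay of coefficients -/

section CompactEmbedding

variable {V H : Type*} [NormedAddCommGroup V] [InnerProductSpace ℝ V]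
  [NormedAddCommGroup H] [InnerProductSpace ℝ H] [CompleteSpace H]

/-- Truncating to the first `N` basis vectors gives finite-rank operators within `1 / (N + 1)` of
`J` in norm. -/
theorem isCompactOperator_of_sum_sq_le (b : HilbertBasis ℕ ℝ H) (J : V →L[ℝ] H)
    (h : ∀ w M, ∑ k ∈ Finset.range M, (((k : ℝ) + 1) * inner ℝ (b k) (J w)) ^ 2 ≤ ‖w‖ ^ 2) :
    IsCompactOperator J := by
  let P : ℕ → H →L[ℝ] H := fun N => ∑ k ∈ Finset.range N, InnerProductSpace.rankOne ℝ (b k) (b k)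
  have hP : ∀ N y, P N y = ∑ k ∈ Finset.range N, inner ℝ (b k) y • b k := by
    intro N y
    simp [P]
  have hPc : ∀ N, IsCompactOperator (P N) := by
    intro N
    have h1 : P N ∈ compactOperator (RingHom.id ℝ) H H := by
      refine Submodule.sum_mem _ fun k _ => ?_
      change IsCompactOperator (InnerProductSpace.rankOne ℝ (b k) (b k))
      rw [InnerProductSpace.rankOne_def']
      exact (isCompactOperator_of_locallyCompactSpace_rng
        (ContinuousLinearMap.toSpanSingleton ℝ (b k))).comp_clm _
    exact h1
  have hbound : ∀ N, ‖P N ∘L J - J‖ ≤ ((N : ℝ) + 1)⁻¹ := by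
    intro N
    refine ContinuousLinearMap.opNorm_le_bound _ (by positivity) fun w => ?_
    change ‖P N (J w) - J w‖ ≤ _
    rw [norm_sub_rev]
    refine (sq_le_sq₀ (norm_nonneg _) (by positivity)).1 ?_
    have h1 := (b.hasSum_inner_mul_inner (J w - P N (J w)) (J w - P N (J w))).tendsto_sum_nat
    simp only [real_inner_self_eq_norm_sq, real_inner_comm, ← sq] at h1
    refine le_of_tendsto' h1 fun M => ?_
    have h2 : ∀ k ∈ Finset.range M, inner ℝ (b k) (J w - P N (J w)) ^ 2 ≤
        (((N : ℝ) + 1)⁻¹) ^ 2 * (((k : ℝ) + 1) * inner ℝ (b k) (J w)) ^ 2 := by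
      intro k _
      rw [inner_sub_right, hP]
      by_cases hk : k ∈ Finset.range N
      · rw [b.orthonormal.inner_right_sum _ hk, sub_self, zero_pow two_ne_zero]
        positivity
      · have h3 : inner ℝ (b k) (∑ i ∈ Finset.range N, inner ℝ (b i) (J w) • b i) = 0 := by
          rw [inner_sum]
          refine Finset.sum_eq_zero fun i hi => ?_
          rw [real_inner_smul_right, b.orthonormal.2 (by rintro rfl; exact hk hi), mul_zero]
        rw [h3, sub_zero, ← mul_pow, ← mul_assoc, mul_pow]
        refine le_mul_of_one_le_left (sq_nonneg _) (one_le_pow₀ ?_)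
        rw [Finset.mem_range, not_lt] at hk
        rw [inv_mul_eq_div, one_le_div (by positivity)]
        have : (N : ℝ) ≤ k := by exact_mod_cast hk
        linarith
    refine (Finset.sum_le_sum h2).trans ?_
    rw [← Finset.mul_sum, mul_pow]
    exact mul_le_mul_of_nonneg_left (h w M) (sq_nonneg _)
  refine isCompactOperator_of_tendsto (l := atTop) (F := fun N => P N ∘L J) ?_
    (Eventually.of_forall fun N => (hPc N).comp_clm J)
  rw [tendsto_iff_norm_sub_tendsto_zero]
  refine squeeze_zero (fun _ => norm_nonneg _) hbound ?_
  simpa only [one_div] using tendsto_one_div_add_atTop_nhds_zero_nat (𝕜 := ℝ)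

end CompactEmbedding

/-! ### The space `H¹₀(0, π)`: sines in it, compact and dense embedding -/

section SobolevSpace

/-- Integration by parts for test functions; both sides are continuous in `p`, so the identity
passes to the closure. -/
theorem inner_cosL2_eq_of_mem_sobolevH10 {p : IntervalL2 × IntervalL2} (hp : p ∈ sobolevH10)
    (m : ℕ) : inner ℝ (cosL2 m) p.2 = m * inner ℝ (sinL2 m) p.1 := by
  let K : Submodule ℝ (IntervalL2 × IntervalL2) := LinearMap.ker
    ((innerSL ℝ (cosL2 m)) ∘L ContinuousLinearMap.snd ℝ IntervalL2 IntervalL2 -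
      (m : ℝ) • ((innerSL ℝ (sinL2 m)) ∘L ContinuousLinearMap.fst ℝ IntervalL2 IntervalL2) :
      IntervalL2 × IntervalL2 →L[ℝ] ℝ).toLinearMap
  have hK : ∀ r, r ∈ K ↔ inner ℝ (cosL2 m) r.2 = m * inner ℝ (sinL2 m) r.1 := by
    intro r
    rw [LinearMap.mem_ker]
    exact sub_eq_zero
  have hKc : IsClosed (K : Set (IntervalL2 × IntervalL2)) := ContinuousLinearMap.isClosed_ker _
  rw [← hK]
  refine Submodule.topologicalClosure_minimal _ (Submodule.span_le.2 ?_) hKc hp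
  rintro r ⟨φ, hφ, -, hφs, h1, h2⟩
  rw [SetLike.mem_coe, hK, cosL2, sinL2, inner_continuousToL2_left, inner_continuousToL2_left]
  have e1 : ∫ x, Real.cos (m * x) * r.2 x ∂intervalMeasure =
      ∫ x in (0 : ℝ)..Real.pi, Real.cos (m * x) * deriv φ x := by
    rw [← integral_intervalMeasure]
    refine integral_congr_ae ?_
    filter_upwards [h2] with x hx
    rw [hx]
  have e2 : ∫ x, Real.sin (m * x) * r.1 x ∂intervalMeasure =
      ∫ x in (0 : ℝ)..Real.pi, Real.sin (m * x) * φ x := by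
    rw [← integral_intervalMeasure]
    refine integral_congr_ae ?_
    filter_upwards [h1] with x hx
    rw [hx]
  simp only [ContinuousMap.coe_mk]
  rw [e1, e2]
  have z0 : φ 0 = 0 := image_eq_zero_of_notMem_tsupport fun h => lt_irrefl _ (hφs h).1
  have z1 : φ Real.pi = 0 := image_eq_zero_of_notMem_tsupport fun h => lt_irrefl _ (hφs h).2
  have hd : ContDiff ℝ 1 φ := hφ.of_le (by exact_mod_cast le_top)
  have hcos : ∀ x : ℝ, HasDerivAt (fun x : ℝ => Real.cos (m * x)) (-(m * Real.sin (m * x))) x := by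
    intro x
    have := ((hasDerivAt_id x).const_mul (m : ℝ)).cos
    simpa [mul_comm] using this
  rw [intervalIntegral.integral_mul_deriv_eq_deriv_mul (fun x _ => hcos x)
    (fun x _ => (hd.differentiable one_ne_zero x).hasDerivAt)
    (Continuous.intervalIntegrable (by fun_prop) _ _)
    ((hd.continuous_deriv le_rfl).intervalIntegrable _ _), z0, z1]
  simp only [neg_mul, mul_assoc]
  rw [intervalIntegral.integral_neg, intervalIntegral.integral_const_mul]
  ring

theorem tendsto_continuousToL2 {F : ℕ → C(ℝ, ℝ)} {f : C(ℝ, ℝ)} {C : ℝ}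
    (hb : ∀ n, ∀ x ∈ Ioo 0 Real.pi, |F n x - f x| ≤ C)
    (hlim : ∀ x ∈ Ioo 0 Real.pi, ∀ᶠ n in atTop, F n x = f x) :
    Tendsto (fun n => continuousToL2 (F n)) atTop (𝓝 (continuousToL2 f)) := by
  rw [tendsto_iff_norm_sub_tendsto_zero]
  have h1 : ∀ n, ‖continuousToL2 (F n) - continuousToL2 f‖ =
      √(∫ x, (F n x - f x) ^ 2 ∂intervalMeasure) := by
    intro n
    rw [← Real.sqrt_sq (norm_nonneg (continuousToL2 (F n) - continuousToL2 f)),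
      ← real_inner_self_eq_norm_sq, inner_intervalL2]
    congr 1
    refine integral_congr_ae ?_
    filter_upwards [coeFn_continuousToL2 (F n), coeFn_continuousToL2 f,
      Lp.coeFn_sub (continuousToL2 (F n)) (continuousToL2 f)] with x h1 h2 h3
    rw [h3, Pi.sub_apply, h1, h2, sq]
  simp only [h1]
  rw [← Real.sqrt_zero]
  refine (Real.continuous_sqrt.tendsto 0).comp ?_
  have h2 := tendsto_integral_of_dominated_convergence (μ := intervalMeasure)
    (F := fun n x => (F n x - f x) ^ 2) (f := fun _ => 0) (fun _ => C ^ 2)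
    (fun n => (by fun_prop : Continuous fun x => (F n x - f x) ^ 2).aestronglyMeasurable)
    (integrable_const _)
    (fun n => ae_intervalMeasure_of_forall_mem fun x hx => by
      rw [Real.norm_eq_abs, abs_pow]
      exact pow_le_pow_left₀ (abs_nonneg _) (hb n x hx) 2)
    (ae_intervalMeasure_of_forall_mem fun x hx => by
      refine tendsto_const_nhds.congr' ?_
      filter_upwards [hlim x hx] with n hn
      rw [hn]; ring)
  simpa using h2

/-- Stated in terms of `y + 1` because the cutoffs below use `y = n x (π - x) - 1`; the last bound
absorbs the factor `n` of their derivatives. -/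
theorem Real.exists_abs_deriv_smoothTransition_le :
    ∃ B, 0 ≤ B ∧ ∀ y, |deriv Real.smoothTransition y| ≤ B ∧
      (2 < y + 1 → deriv Real.smoothTransition y = 0) ∧
      |y + 1| * |deriv Real.smoothTransition y| ≤ 2 * B := by
  have hc : Continuous (deriv Real.smoothTransition) :=
    (Real.smoothTransition.contDiff (n := 1)).continuous_deriv le_rfl
  obtain ⟨B, hB⟩ := isCompact_Icc.exists_bound_of_continuousOn (s := Icc (0 : ℝ) 1) hc.continuousOn
  have hB0 : 0 ≤ B := (norm_nonneg _).trans (hB 0 (by simp))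
  have hgt : ∀ y, 1 < y → deriv Real.smoothTransition y = 0 := by
    intro y hy
    have : Real.smoothTransition =ᶠ[𝓝 y] fun _ => 1 := by
      filter_upwards [lt_mem_nhds hy] with z hz
      exact Real.smoothTransition.one_of_one_le hz.le
    rw [this.deriv_eq, deriv_const]
  have hlt : ∀ y < 0, deriv Real.smoothTransition y = 0 := by
    intro y hy
    have : Real.smoothTransition =ᶠ[𝓝 y] fun _ => 0 := by
      filter_upwards [gt_mem_nhds hy] with z hz
      exact Real.smoothTransition.zero_of_nonpos hz.le
    rw [this.deriv_eq, deriv_const]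
  refine ⟨B, hB0, fun y => ?_⟩
  rcases lt_or_ge y 0 with h | h
  · rw [hlt y h]; simpa using hB0
  rcases lt_or_ge 1 y with h' | h'
  · rw [hgt y h']; simpa using hB0
  have := hB y ⟨h, h'⟩
  refine ⟨this, fun h2 => absurd h2 (by linarith), ?_⟩
  rw [abs_of_nonneg (by linarith)]
  exact mul_le_mul (by linarith) this (abs_nonneg _) zero_le_two

/-- A smooth function that vanishes at the endpoints lies in `H¹₀(0, π)`. -/
theorem mem_sobolevH10_of_contDiff {s : ℝ → ℝ} (hs : ContDiff ℝ ∞ s) {C : ℝ}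
    (hC : ∀ x ∈ Ioo 0 Real.pi, |s x| ≤ C * (x * (Real.pi - x))) {s' : C(ℝ, ℝ)}
    (hs' : ∀ x, HasDerivAt s (s' x) x) :
    (continuousToL2 ⟨s, hs.continuous⟩, continuousToL2 s') ∈ sobolevH10 := by
  obtain ⟨B, hB0, hB⟩ := Real.exists_abs_deriv_smoothTransition_le
  let p : ℝ → ℝ := fun x => x * (Real.pi - x)
  have hp : ∀ x, HasDerivAt p (Real.pi - 2 * x) x := by
    intro x
    have := (hasDerivAt_id x).mul ((hasDerivAt_id x).const_sub Real.pi)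
    refine this.congr_deriv ?_
    simp only [id]; ring
  have hpc : ContDiff ℝ ∞ p := by fun_prop
  have hppos : ∀ x ∈ Ioo 0 Real.pi, 0 < p x := fun x hx => mul_pos hx.1 (sub_pos.2 hx.2)
  -- A cutoff that is `0` where `n p ≤ 1` and `1` where `n p ≥ 2`.
  let χ : ℕ → ℝ → ℝ := fun n x => Real.smoothTransition (n * p x - 1)
  have hχc : ∀ n, ContDiff ℝ ∞ (χ n) := fun n =>
    Real.smoothTransition.contDiff.comp ((contDiff_const.mul hpc).sub contDiff_const)
  let χ' : ℕ → ℝ → ℝ := fun n x =>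
    deriv Real.smoothTransition (n * p x - 1) * (n * (Real.pi - 2 * x))
  have hχ' : ∀ n x, HasDerivAt (χ n) (χ' n x) x := by
    intro n x
    have h1 := ((Real.smoothTransition.contDiff (n := 1)).differentiable one_ne_zero
      (n * p x - 1)).hasDerivAt
    exact h1.comp x (((hp x).const_mul (n : ℝ)).sub_const 1)
  have hχ'c : ∀ n, Continuous (χ' n) := by
    intro n
    have := (Real.smoothTransition.contDiff (n := 1)).continuous_deriv le_rfl
    exact (this.comp (by fun_prop)).mul (by fun_prop)
  let F : ℕ → C(ℝ, ℝ) := fun n => ⟨fun x => χ n x * s x, (hχc n).continuous.mul hs.continuous⟩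
  let G : ℕ → C(ℝ, ℝ) := fun n => ⟨fun x => χ' n x * s x + χ n x * s' x,
    ((hχ'c n).mul hs.continuous).add ((hχc n).continuous.mul s'.continuous)⟩
  have hev : ∀ x ∈ Ioo 0 Real.pi, ∀ᶠ n : ℕ in atTop, 2 < (n : ℝ) * p x := by
    intro x hx
    filter_upwards [tendsto_natCast_atTop_atTop.eventually_gt_atTop (2 / p x)] with n hn
    rwa [div_lt_iff₀ (hppos x hx)] at hn
  have hχ1 : ∀ n x, |χ n x - 1| ≤ 1 := by
    intro n x
    rw [abs_le]
    constructor <;> linarith [Real.smoothTransition.nonneg (n * p x - 1),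
      Real.smoothTransition.le_one (n * p x - 1)]
  have hbdd : ∀ f : C(ℝ, ℝ), ∃ K, ∀ x ∈ Ioo 0 Real.pi, |f x| ≤ K := by
    intro f
    obtain ⟨K, hK⟩ := isCompact_Icc.exists_bound_of_continuousOn (s := Icc 0 Real.pi)
      f.continuous.continuousOn
    exact ⟨K, fun x hx => hK x (Ioo_subset_Icc_self hx)⟩
  obtain ⟨K, hK⟩ := hbdd ⟨s, hs.continuous⟩
  obtain ⟨K', hK'⟩ := hbdd s'
  have hF : Tendsto (fun n => continuousToL2 (F n)) atTop
      (𝓝 (continuousToL2 ⟨s, hs.continuous⟩)) := by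
    refine tendsto_continuousToL2 (C := K) (fun n x hx => ?_) fun x hx => ?_
    · have : F n x - s x = (χ n x - 1) * s x := by simp only [F, ContinuousMap.coe_mk]; ring
      simp only [ContinuousMap.coe_mk]
      rw [this, abs_mul]
      exact (mul_le_of_le_one_left (abs_nonneg _) (hχ1 n x)).trans (hK x hx)
    · filter_upwards [hev x hx] with n hn
      simp only [F, ContinuousMap.coe_mk, χ]
      rw [Real.smoothTransition.one_of_one_le (by linarith), one_mul]
  have hG : Tendsto (fun n => continuousToL2 (G n)) atTop (𝓝 (continuousToL2 s')) := by
    -- The derivative of the cutoff grows like `n`, but `|s| ≤ C p` and the bound on `n p` times the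
    -- transition's derivative keep `χ' s` bounded by `2 B π C`.
    refine tendsto_continuousToL2 (C := 2 * B * Real.pi * C + K') (fun n x hx => ?_) fun x hx => ?_
    · have h1 : G n x - s' x = χ' n x * s x + (χ n x - 1) * s' x := by
        simp only [G, ContinuousMap.coe_mk]; ring
      rw [h1]
      refine (abs_add_le _ _).trans (add_le_add ?_ ?_)
      · have h2 := (hB (n * p x - 1)).2.2
        rw [sub_add_cancel] at h2
        have hnp : 0 ≤ (n : ℝ) * p x := mul_nonneg n.cast_nonneg (hppos x hx).le
        rw [abs_of_nonneg hnp] at h2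
        have hC0 : 0 ≤ C := by
          have := (abs_nonneg _).trans (hC x hx)
          exact nonneg_of_mul_nonneg_left this (hppos x hx)
        have h3 : |Real.pi - 2 * x| ≤ Real.pi := by
          rw [abs_le]; constructor <;> linarith [hx.1, hx.2]
        calc |χ' n x * s x|
            = |deriv Real.smoothTransition (n * p x - 1)| * (n * |Real.pi - 2 * x|) * |s x| := by
              simp only [χ', abs_mul, Nat.abs_cast]
          _ ≤ |deriv Real.smoothTransition (n * p x - 1)| * (n * Real.pi) * (C * p x) := by
              have := hC x hx
              gcongr
          _ = (n * p x * |deriv Real.smoothTransition (n * p x - 1)|) * (Real.pi * C) := by ring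
          _ ≤ 2 * B * (Real.pi * C) :=
              mul_le_mul_of_nonneg_right h2 (mul_nonneg Real.pi_pos.le hC0)
          _ = 2 * B * Real.pi * C := by ring
      · rw [abs_mul]
        exact (mul_le_of_le_one_left (abs_nonneg _) (hχ1 n x)).trans (hK' x hx)
    · filter_upwards [hev x hx] with n hn
      simp only [G, ContinuousMap.coe_mk, χ, χ']
      rw [Real.smoothTransition.one_of_one_le (by linarith),
        (hB (n * p x - 1)).2.1 (by linarith)]
      ring
  refine (Submodule.isClosed_topologicalClosure _).mem_of_tendsto (hF.prodMk_nhds hG)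
    (Eventually.of_forall fun n => ?_)
  refine Submodule.le_topologicalClosure _ (Submodule.subset_span ?_)
  have hsub : tsupport (F n) ⊆ {x | 1 ≤ n * p x} := by
    refine closure_minimal (fun x hx => ?_)
      (isClosed_le continuous_const (continuous_const.mul hpc.continuous))
    by_contra h
    rw [mem_ofPred_eq, not_le] at h
    exact hx (by simp only [F, ContinuousMap.coe_mk, χ,
      Real.smoothTransition.zero_of_nonpos (by linarith : n * p x - 1 ≤ 0), zero_mul])
  have hsub2 : tsupport (F n) ⊆ Ioo 0 Real.pi := by
    intro x hx
    have h1 : 1 ≤ n * p x := hsub hx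
    have h2 : 0 < p x := by
      by_contra h
      have := mul_nonpos_of_nonneg_of_nonpos (Nat.cast_nonneg (α := ℝ) n) (not_lt.1 h)
      linarith
    have hpi := Real.pi_pos
    rcases mul_pos_iff.1 h2 with ⟨h3, h4⟩ | ⟨h3, h4⟩
    · exact ⟨h3, by linarith⟩
    · linarith
  refine ⟨F n, (hχc n).mul hs, ?_, hsub2, coeFn_continuousToL2 _, ?_⟩
  · exact isCompact_Icc.of_isClosed_subset (isClosed_tsupport _)
      (hsub2.trans Ioo_subset_Icc_self)
  · have : deriv (F n) = G n := by
      ext x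
      exact ((hχ' n x).mul (hs' x)).deriv
    rw [this]
    exact coeFn_continuousToL2 _

theorem continuousToL2_smul (c : ℝ) (f : C(ℝ, ℝ)) :
    continuousToL2 (c • f) = c • continuousToL2 f :=
  MemLp.toLp_const_smul c (f.continuous.memLp_intervalMeasure 2)

/-- By reflection `|sin mx|` is at most both `m x` and `m (π - x)`; add these bounds with weights `π
- x` and `x`. -/
theorem abs_sin_nat_mul_le (m : ℕ) {x : ℝ} (hx : x ∈ Ioo 0 Real.pi) :
    |Real.sin (m * x)| ≤ 2 * m / Real.pi * (x * (Real.pi - x)) := by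
  have hsin : ∀ y : ℝ, 0 ≤ y → |Real.sin (m * y)| ≤ m * y := by
    intro y hy
    have h : 0 ≤ m * y := mul_nonneg m.cast_nonneg hy
    have := Real.abs_sin_le_abs (x := m * y)
    rwa [abs_of_nonneg h] at this
  have h1 := hsin x hx.1.le
  have h2 := hsin (Real.pi - x) (sub_nonneg.2 hx.2.le)
  have h3 : |Real.sin (m * (Real.pi - x))| = |Real.sin (m * x)| := by
    rw [mul_sub, Real.sin_nat_mul_pi_sub, abs_neg, abs_mul, abs_pow, abs_neg, abs_one, one_pow,
      one_mul]
  rw [h3] at h2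
  have h4 := mul_le_mul_of_nonneg_left h1 (sub_nonneg.2 hx.2.le)
  have h5 := mul_le_mul_of_nonneg_left h2 hx.1.le
  rw [div_mul_eq_mul_div, le_div_iff₀ Real.pi_pos]
  linarith

theorem sinL2_mem_sobolevH10 (m : ℕ) : (sinL2 m, (m : ℝ) • cosL2 m) ∈ sobolevH10 := by
  rw [cosL2, ← continuousToL2_smul]
  refine mem_sobolevH10_of_contDiff (by fun_prop) (fun x hx => abs_sin_nat_mul_le m hx)
    fun x => ?_
  have := ((hasDerivAt_id x).const_mul (m : ℝ)).sin
  simpa [mul_comm] using this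

/-- `H¹₀(0, π)` with the Hilbert space structure of `L² × L²`. -/
noncomputable abbrev sobolevHilbert : Submodule ℝ (WithLp 2 (IntervalL2 × IntervalL2)) :=
  sobolevH10.comap (WithLp.linearEquiv 2 ℝ (IntervalL2 × IntervalL2)).toLinearMap

theorem isClosed_sobolevHilbert :
    IsClosed (sobolevHilbert : Set (WithLp 2 (IntervalL2 × IntervalL2))) :=
  (Submodule.isClosed_topologicalClosure _).preimage (WithLp.prod_continuous_ofLp 2 _ _)

instance : CompleteSpace sobolevHilbert := isClosed_sobolevHilbert.completeSpace_coe

/-- The embedding of `H¹₀(0, π)` into `L²(0, π)`. -/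
noncomputable def sobolevEmbedding : sobolevHilbert →L[ℝ] IntervalL2 :=
  (WithLp.fstL 2 ℝ IntervalL2 IntervalL2) ∘L sobolevHilbert.subtypeL

theorem sobolevEmbedding_apply (w : sobolevHilbert) : sobolevEmbedding w = w.1.fst := rfl

theorem inner_sobolevHilbert (w z : sobolevHilbert) : inner ℝ w z =
    inner ℝ (sobolevEmbedding w) (sobolevEmbedding z) + inner ℝ w.1.snd z.1.snd :=
  WithLp.prod_inner_apply w.1 z.1

/-- The normalised sine functions as elements of `H¹₀(0, π)`. -/
noncomputable def sobolevSin (k : ℕ) : sobolevHilbert :=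
  trigNormalizer •
    ⟨WithLp.toLp 2 (sinL2 (k + 1), ((k + 1 : ℕ) : ℝ) • cosL2 (k + 1)), sinL2_mem_sobolevH10 (k + 1)⟩

theorem sobolevSin_snd (k : ℕ) :
    (sobolevSin k).1.snd = trigNormalizer • ((k + 1 : ℕ) : ℝ) • cosL2 (k + 1) := rfl

/-- The Hilbert basis of normalised sine functions. -/
noncomputable def sinBasis : HilbertBasis ℕ ℝ IntervalL2 :=
  HilbertBasis.mkOfOrthogonalEqBot orthonormal_sinL2 orthogonal_span_sinL2

theorem sinBasis_apply (k : ℕ) : sinBasis k = trigNormalizer • sinL2 (k + 1) :=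
  congrFun (HilbertBasis.coe_mkOfOrthogonalEqBot orthonormal_sinL2 orthogonal_span_sinL2) k

theorem isCompactOperator_sobolevEmbedding : IsCompactOperator sobolevEmbedding := by
  refine isCompactOperator_of_sum_sq_le sinBasis _ fun w M => ?_
  have h1 : ∀ k : ℕ, ((k : ℝ) + 1) * inner ℝ (sinBasis k) (sobolevEmbedding w) =
      inner ℝ (trigNormalizer • cosL2 (k + 1)) w.1.snd := by
    intro k
    have := inner_cosL2_eq_of_mem_sobolevH10 w.2 (k + 1)
    change inner ℝ (cosL2 (k + 1)) w.1.snd = _ * inner ℝ _ w.1.fst at this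
    rw [sinBasis_apply, real_inner_smul_left, real_inner_smul_left, this, sobolevEmbedding_apply]
    push_cast
    ring
  simp only [h1]
  have h2 := orthonormal_cosL2.sum_inner_products_le w.1.snd (s := Finset.range M)
  simp only [Real.norm_eq_abs, sq_abs] at h2
  refine h2.trans ?_
  rw [← real_inner_self_eq_norm_sq, ← real_inner_self_eq_norm_sq, inner_sobolevHilbert]
  exact le_add_of_nonneg_left real_inner_self_nonneg

theorem denseRange_sobolevEmbedding : DenseRange sobolevEmbedding := by
  have h : Dense (LinearMap.range sobolevEmbedding.toLinearMap : Set IntervalL2) := by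
    rw [Submodule.dense_iff_topologicalClosure_eq_top, Submodule.topologicalClosure_eq_top_iff,
      eq_bot_iff, ← orthogonal_span_sinL2]
    refine Submodule.orthogonal_le (Submodule.span_le.2 ?_)
    rintro _ ⟨k, rfl⟩
    exact ⟨sobolevSin k, rfl⟩
  exact h

theorem not_finiteDimensional_intervalL2 : ¬ FiniteDimensional ℝ IntervalL2 := fun _ =>
  Infinite.not_finite (α := ℕ) orthonormal_sinL2.linearIndependent.finite

end SobolevSpace

/-! ### The potential as a bounded symmetric operator -/

section MultiplicationOperator

/-- Multiplication by a continuous function on `L²(0, π)`. -/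
noncomputable def mulL2 (g : C(ℝ, ℝ)) : IntervalL2 →L[ℝ] IntervalL2 :=
  (ContinuousLinearMap.mul ℝ ℝ).holderL intervalMeasure ⊤ 2 2
    ((g.continuous.memLp_intervalMeasure ⊤).toLp g)

theorem coeFn_mulL2 (g : C(ℝ, ℝ)) (u : IntervalL2) :
    mulL2 g u =ᵐ[intervalMeasure] fun x => g x * u x := by
  have h := ContinuousLinearMap.coeFn_holder (r := 2) (ContinuousLinearMap.mul ℝ ℝ)
    ((g.continuous.memLp_intervalMeasure ⊤).toLp g) u
  filter_upwards [h, (g.continuous.memLp_intervalMeasure ⊤).coeFn_toLp] with x h1 h2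
  refine Eq.trans h1 ?_
  rw [h2]
  rfl

theorem inner_mulL2_left (g : C(ℝ, ℝ)) (u v : IntervalL2) :
    inner ℝ (mulL2 g u) v = ∫ x, g x * u x * v x ∂intervalMeasure := by
  rw [inner_intervalL2]
  refine integral_congr_ae ?_
  filter_upwards [coeFn_mulL2 g u] with x hx
  rw [hx]

theorem integrable_continuous_mul_mul_intervalL2 (g : C(ℝ, ℝ)) (u v : IntervalL2) :
    Integrable (fun x => g x * u x * v x) intervalMeasure := by
  refine (integrable_mul_intervalL2 (mulL2 g u) v).congr ?_
  filter_upwards [coeFn_mulL2 g u] with x hx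
  rw [hx]

/-- Multiplication by `g - 1`, the perturbation of the `H¹` inner product. -/
noncomputable def potentialOp (g : C(ℝ, ℝ)) : IntervalL2 →L[ℝ] IntervalL2 := mulL2 g - 1

theorem inner_potentialOp_left (g : C(ℝ, ℝ)) (u v : IntervalL2) :
    inner ℝ (potentialOp g u) v =
      ∫ x, g x * u x * v x ∂intervalMeasure - inner ℝ u v := by
  rw [← inner_mulL2_left, ← inner_sub_left]
  rfl

theorem isSymmetric_potentialOp (g : C(ℝ, ℝ)) : (potentialOp g).IsSymmetric := by
  intro u v
  change inner ℝ (potentialOp g u) v = inner ℝ u (potentialOp g v)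
  rw [real_inner_comm (potentialOp g v), inner_potentialOp_left, inner_potentialOp_left,
    real_inner_comm]
  congr 1
  exact integral_congr_ae (ae_of_all _ fun x => by ring)

theorem neg_norm_mul_sq_le_inner {H : Type*} [NormedAddCommGroup H] [InnerProductSpace ℝ H]
    (Q : H →L[ℝ] H) (u : H) : -(‖Q‖ * ‖u‖ ^ 2) ≤ inner ℝ (Q u) u := by
  have h1 := (abs_le.1 (abs_real_inner_le_norm (Q u) u)).1
  have h2 := mul_le_mul_of_nonneg_right (Q.le_opNorm u) (norm_nonneg u)
  nlinarith

theorem weakForm_sobolev (g : C(ℝ, ℝ)) (w z : sobolevHilbert) :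
    weakForm sobolevEmbedding (potentialOp g) w z =
      inner ℝ w.1.snd z.1.snd + ∫ x, g x * w.1.fst x * z.1.fst x ∂intervalMeasure := by
  rw [weakForm, inner_sobolevHilbert, inner_potentialOp_left]
  simp only [sobolevEmbedding_apply]
  ring

/-- Only the values of `q` on `(0, π)` matter, and continuity of `g` makes the integrability clause
automatic. -/
theorem dirichletEigenspace_eq_weakEigenspace {q : ℝ → ℝ} {g : C(ℝ, ℝ)}
    (hg : ∀ x ∈ Ioo 0 Real.pi, q x = g x) (μ : ℝ) :
    dirichletEigenspace q μ = weakEigenspace sobolevEmbedding (potentialOp g) μ := by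
  have hae : ∀ u v : IntervalL2, (fun x => q x * u x * v x) =ᵐ[intervalMeasure]
      fun x => g x * u x * v x := fun u v => by
    filter_upwards [ae_intervalMeasure_of_forall_mem hg] with x hx
    rw [hx]
  ext u
  constructor
  · rintro ⟨u', hu, h⟩
    refine ⟨⟨WithLp.toLp 2 (u, u'), hu⟩, rfl, fun z => ?_⟩
    have := (h z.1.fst z.1.snd z.2).2
    rw [integral_congr_ae (hae _ _)] at this
    rw [weakForm_sobolev]
    exact this
  · rintro ⟨w, rfl, h⟩
    refine ⟨w.1.snd, w.2, fun v v' hv => ⟨?_, ?_⟩⟩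
    · exact (integrable_congr (hae _ _)).2 (integrable_continuous_mul_mul_intervalL2 g _ _)
    · rw [integral_congr_ae (hae _ _)]
      have := h ⟨WithLp.toLp 2 (v, v'), hv⟩
      rw [weakForm_sobolev] at this
      exact this

end MultiplicationOperator

/-! ### Cosine coefficients: matrix entries, limit, rigidity -/

section CosineSeries

/-- The sum of the cosine series of `q`. -/
noncomputable def cosineSum (q : ℝ → ℝ) (x : ℝ) : ℝ :=
  cosCoeff q 0 / 2 + ∑' k : ℕ, cosCoeff q (k + 1) * Real.cos (((k + 1 : ℕ) : ℝ) * x)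

variable {q : ℝ → ℝ}

theorem HasCosineExpansion.continuous_cosineSum (hq : HasCosineExpansion q) :
    Continuous (cosineSum q) := by
  refine continuous_const.add (continuous_tsum (fun k => by fun_prop)
    ((summable_nat_add_iff 1).2 hq.summable_abs) fun k x => ?_)
  rw [Real.norm_eq_abs, abs_mul]
  exact mul_le_of_le_one_right (abs_nonneg _) (Real.abs_cos_le_one _)

theorem HasCosineExpansion.eq_cosineSum (hq : HasCosineExpansion q) {x : ℝ}
    (hx : x ∈ Icc 0 Real.pi) : q x = cosineSum q x := by
  rw [cosineSum, (hq.hasSum x hx).tsum_eq]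
  ring

theorem HasCosineExpansion.intervalIntegrable_mul (hq : HasCosineExpansion q) {f : ℝ → ℝ}
    (hf : Continuous f) : IntervalIntegrable (fun x => q x * f x) volume 0 Real.pi := by
  refine ((hq.continuous_cosineSum.mul hf).intervalIntegrable 0 Real.pi).congr ?_
  intro x hx
  rw [uIoc_of_le Real.pi_pos.le] at hx
  change cosineSum q x * f x = q x * f x
  rw [hq.eq_cosineSum (Ioc_subset_Icc_self hx)]

theorem HasCosineExpansion.integral_mul_sin_mul_sin (hq : HasCosineExpansion q) {m n : ℕ}
    (hmn : m ≤ n) : 2 / Real.pi * ∫ x in (0 : ℝ)..Real.pi, q x * Real.sin (m * x) *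
      Real.sin (n * x) = (cosCoeff q (n - m) - cosCoeff q (n + m)) / 2 := by
  have h : ∀ x : ℝ, q x * Real.sin (m * x) * Real.sin (n * x) =
      (q x * Real.cos (((n - m : ℕ) : ℝ) * x) - q x * Real.cos (((n + m : ℕ) : ℝ) * x)) / 2 := by
    intro x
    rw [mul_assoc, mul_comm (Real.sin (m * x)), Real.sin_mul_sin_eq, Nat.cast_sub hmn,
      Nat.cast_add, sub_mul, add_mul]
    ring
  simp only [h]
  rw [intervalIntegral.integral_div, intervalIntegral.integral_sub
    (hq.intervalIntegrable_mul (by fun_prop)) (hq.intervalIntegrable_mul (by fun_prop)),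
    cosCoeff, cosCoeff]
  ring

/-- `sobolevSin k` has frequency `k + 1`, so the difference and the sum of frequencies are `j - k`
and `j + k + 2`. -/
theorem HasCosineExpansion.weakForm_sobolevSin (hq : HasCosineExpansion q) {g : C(ℝ, ℝ)}
    (hg : ∀ x ∈ Ioo 0 Real.pi, q x = g x) {k j : ℕ} (hkj : k ≤ j) :
    weakForm sobolevEmbedding (potentialOp g) (sobolevSin k) (sobolevSin j) =
      (if k = j then ((k : ℝ) + 1) ^ 2 else 0) +
        (cosCoeff q (j - k) - cosCoeff q (j + k + 2)) / 2 := by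
  rw [weakForm_sobolev]
  congr 1
  · rw [sobolevSin_snd, sobolevSin_snd, real_inner_smul_left, real_inner_smul_left,
      real_inner_smul_right, real_inner_smul_right, inner_cosL2_cosL2 k.succ_ne_zero]
    have h1 := trigNormalizer_sq
    by_cases h : k = j
    · subst h
      simp only [if_true]
      have h2 : trigNormalizer * (((k + 1 : ℕ) : ℝ) * (trigNormalizer * (((k + 1 : ℕ) : ℝ) *
          (Real.pi / 2)))) = trigNormalizer ^ 2 * (Real.pi / 2) * ((k : ℝ) + 1) ^ 2 := by
        push_cast; ring
      rw [h2, h1]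
      field_simp
    · rw [if_neg (by omega), if_neg h]; simp
  · have h1 := hq.integral_mul_sin_mul_sin (Nat.succ_le_succ hkj)
    rw [show j.succ - k.succ = j - k by omega, show j.succ + k.succ = j + k + 2 by omega] at h1
    rw [← h1, ← trigNormalizer_sq, ← integral_intervalMeasure, ← integral_const_mul]
    refine integral_congr_ae ?_
    have hs : ∀ i : ℕ, (sobolevSin i).1.fst =ᵐ[intervalMeasure]
        fun x => trigNormalizer * Real.sin (((i + 1 : ℕ) : ℝ) * x) := by
      intro i
      change (trigNormalizer • sinL2 (i + 1) : IntervalL2) =ᵐ[intervalMeasure] _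
      filter_upwards [Lp.coeFn_smul trigNormalizer (sinL2 (i + 1)), coeFn_sinL2 (i + 1)]
        with x h1 h2
      rw [h1, Pi.smul_apply, h2, smul_eq_mul]
    filter_upwards [hs k, hs j, ae_intervalMeasure_of_forall_mem hg] with x h1 h2 h3
    rw [h1, h2, h3]
    simp only [Nat.succ_eq_add_one]
    ring

theorem HasCosineExpansion.tendsto_sum_even (hq : HasCosineExpansion q) :
    Tendsto (fun n : ℕ => -(1 / 2) * ∑ k ∈ Finset.Icc 1 n, cosCoeff q (2 * k)) atTop
      (𝓝 (1 / 2 * (1 / Real.pi * ∫ x in (0 : ℝ)..Real.pi, q x) - (q 0 + q Real.pi) / 4)) := by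
  have hpi := Real.pi_pos.le
  have h0 := hq.hasSum 0 ⟨le_rfl, hpi⟩
  have h1 := hq.hasSum Real.pi ⟨hpi, le_rfl⟩
  have h2 := (h0.add h1).div_const 2
  -- Index `k` of the series carries frequency `k + 1`, so even frequencies sit at odd indices; in
  -- the average of the values at `0` and `π` the others cancel.
  have h3 : Function.Injective fun k : ℕ => 2 * k + 1 := fun a b h => by
    have : 2 * a + 1 = 2 * b + 1 := h
    omega
  have h4 : HasSum (fun k : ℕ => cosCoeff q (2 * (k + 1)))
      ((q 0 - cosCoeff q 0 / 2 + (q Real.pi - cosCoeff q 0 / 2)) / 2) := by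
    rw [← h3.hasSum_iff] at h2
    · refine (congrArg (HasSum · _) (funext fun k => ?_)).mpr h2
      have h5 : Real.cos (((2 * k + 1 + 1 : ℕ) : ℝ) * Real.pi) = 1 := by
        rw [Real.cos_nat_mul_pi]
        exact Even.neg_one_pow ⟨k + 1, by ring⟩
      rw [Function.comp_apply, h5, mul_zero, Real.cos_zero, show 2 * (k + 1) = 2 * k + 1 + 1 by ring]
      ring
    · intro k hk
      have hk' : Odd (k + 1) := by
        by_contra h
        rw [Nat.not_odd_iff_even] at h
        obtain ⟨j, hj⟩ := h
        exact hk ⟨j - 1, show 2 * (j - 1) + 1 = k by omega⟩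
      rw [Real.cos_nat_mul_pi, hk'.neg_one_pow, mul_zero, Real.cos_zero]
      ring
  have hq0 : 1 / Real.pi * ∫ x in (0 : ℝ)..Real.pi, q x = cosCoeff q 0 / 2 := by
    simp [cosCoeff]; ring
  rw [hq0]
  have h5 := (h4.tendsto_sum_nat).const_mul (-(1 / 2))
  have h6 : -(1 / 2) * ((q 0 - cosCoeff q 0 / 2 + (q Real.pi - cosCoeff q 0 / 2)) / 2) =
      1 / 2 * (cosCoeff q 0 / 2) - (q 0 + q Real.pi) / 4 := by ring
  rw [h6] at h5
  refine h5.congr fun n => ?_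
  rw [Finset.range_eq_Ico, Finset.sum_Ico_add' (fun k => cosCoeff q (2 * k)) 0 n 1]
  rfl

/-- A periodic sequence that tends to zero vanishes, leaving only the constant term. -/
theorem HasCosineExpansion.const_of_periodic (hq : HasCosineExpansion q) {n : ℕ} (hn : 1 ≤ n)
    (h : ∀ m, 1 ≤ m → cosCoeff q m = cosCoeff q (m + 2 * n)) :
    ∃ c : ℝ, ∀ x ∈ Icc (0 : ℝ) Real.pi, q x = c := by
  have hz : ∀ m, 1 ≤ m → cosCoeff q m = 0 := by
    intro m hm
    have h1 : ∀ i : ℕ, cosCoeff q (m + i * (2 * n)) = cosCoeff q m := by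
      intro i
      induction i with
      | zero => simp
      | succ i ih => rw [← ih, h (m + i * (2 * n)) (by omega)]; congr 1; ring
    have h2 : Tendsto (cosCoeff q) atTop (𝓝 0) := hq.summable_abs.of_abs.tendsto_atTop_zero
    have h3 : Tendsto (fun i : ℕ => m + i * (2 * n)) atTop atTop :=
      tendsto_atTop_mono (fun i => (Nat.le_mul_of_pos_right i (by omega)).trans
        (Nat.le_add_left _ m)) tendsto_id
    have h4 := h2.comp h3
    simp only [Function.comp_def, h1] at h4
    exact tendsto_nhds_unique tendsto_const_nhds h4
  refine ⟨cosCoeff q 0 / 2, fun x hx => ?_⟩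
  have := hq.hasSum x hx
  simp only [hz _ (Nat.le_add_left 1 _), zero_mul] at this
  linarith [this.unique hasSum_zero]

end CosineSeries

/-! ### Reindexing from zero, and the main theorem -/

section MainTheorem

theorem isDirichletEigenvalueSeq_iff {q : ℝ → ℝ} {ev : ℕ → ℝ} {E : ℝ → Submodule ℝ IntervalL2}
    (hE : ∀ μ, dirichletEigenspace q μ = E μ) (hfd : ∀ μ, FiniteDimensional ℝ (E μ)) :
    IsDirichletEigenvalueSeq q ev ↔ Monotone (fun k => ev (k + 1)) ∧
      ∀ μ, {k | ev (k + 1) = μ}.encard = Module.finrank ℝ (E μ) := by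
  obtain rfl : dirichletEigenspace q = E := funext hE
  have h1 : ∀ μ, {k : ℕ | 1 ≤ k ∧ ev k = μ} = Nat.succ '' {k | ev (k + 1) = μ} := by
    intro μ
    ext k
    constructor
    · rintro ⟨hk, hk'⟩
      exact ⟨k - 1, by rwa [mem_ofPred_eq, Nat.sub_add_cancel hk], Nat.succ_pred_eq_of_pos hk⟩
    · rintro ⟨j, hj, rfl⟩
      exact ⟨Nat.succ_pos j, hj⟩
  have h2 : ∀ μ, Cardinal.toENat (Module.rank ℝ (dirichletEigenspace q μ)) =
      Module.finrank ℝ (dirichletEigenspace q μ) := by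
    intro μ
    rw [← Module.finrank_eq_rank, Cardinal.toENat_nat]
  constructor
  · rintro ⟨hm, hmult⟩
    refine ⟨fun i j hij => hm (Nat.le_add_left 1 i) (Nat.le_add_left 1 j) (by omega), fun μ => ?_⟩
    rw [← h2, ← hmult, h1, Nat.succ_injective.encard_image]
  · rintro ⟨hm, hmult⟩
    refine ⟨fun i hi j hj hij => ?_, fun μ => ?_⟩
    · have hi : 1 ≤ i := hi
      have := hm (show i - 1 ≤ j - 1 by omega)
      dsimp only at this
      rwa [Nat.sub_add_cancel hi, Nat.sub_add_cancel hj] at this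
    · rw [h2, ← hmult, h1, Nat.succ_injective.encard_image]

end MainTheorem

theorem mainTheorem1 (q : ℝ → ℝ) (hq : HasCosineExpansion q) :
    (∃ ev : ℕ → ℝ, IsDirichletEigenvalueSeq q ev) ∧
    (∀ ev : ℕ → ℝ, IsDirichletEigenvalueSeq q ev → ∀ n : ℕ, 1 ≤ n →
      ∑ k ∈ Finset.Icc 1 n, (ev k - (k : ℝ) ^ 2 - cosCoeff q 0 / 2) ≤
          -(1 / 2) * ∑ k ∈ Finset.Icc 1 n, cosCoeff q (2 * k) ∧
      (∑ k ∈ Finset.Icc 1 n, (ev k - (k : ℝ) ^ 2 - cosCoeff q 0 / 2) =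
          -(1 / 2) * ∑ k ∈ Finset.Icc 1 n, cosCoeff q (2 * k) →
        ∃ c : ℝ, ∀ x ∈ Icc (0 : ℝ) Real.pi, q x = c)) ∧
    Tendsto (fun n : ℕ => -(1 / 2) * ∑ k ∈ Finset.Icc 1 n, cosCoeff q (2 * k)) atTop
      (𝓝 (1 / 2 * (1 / Real.pi * ∫ x in (0 : ℝ)..Real.pi, q x) -
        (q 0 + q Real.pi) / 4)) := by
  let g : C(ℝ, ℝ) := ⟨cosineSum q, hq.continuous_cosineSum⟩
  have hg : ∀ x ∈ Ioo 0 Real.pi, q x = g x := fun x hx => hq.eq_cosineSum (Ioo_subset_Icc_self hx)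
  let Q := potentialOp g
  have hE : ∀ μ, dirichletEigenspace q μ = weakEigenspace sobolevEmbedding Q μ :=
    dirichletEigenspace_eq_weakEigenspace hg
  have hQ : Q.IsSymmetric := isSymmetric_potentialOp g
  have hc : ∀ u, -(‖Q‖ * ‖u‖ ^ 2) ≤ inner ℝ (Q u) u := neg_norm_mul_sq_le_inner Q
  have hJ := isCompactOperator_sobolevEmbedding
  have hd := denseRange_sobolevEmbedding
  have horth := orthogonalFamily_weakEigenspace (J := sobolevEmbedding) hQ
  have hfd := finiteDimensional_weakEigenspace hQ hJ hd hc
  have htot := orthogonal_iSup_weakEigenspace hQ hJ hd hc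
  have hiff : ∀ ev, IsDirichletEigenvalueSeq q ev ↔ Monotone (fun k => ev (k + 1)) ∧
      ∀ μ, {k | ev (k + 1) = μ}.encard =
        Module.finrank ℝ (weakEigenspace sobolevEmbedding Q μ) :=
    fun ev => isDirichletEigenvalueSeq_iff hE hfd
  refine ⟨?_, fun ev hev n hn => ?_, hq.tendsto_sum_even⟩
  · obtain ⟨σ, hσ, hmult⟩ := exists_monotone_eigenvalue_seq horth hfd htot
      not_finiteDimensional_intervalL2
      fun ι ψ f hψ hf t => hψ.finite_setOf_weakEigenvalue_le hQ hJ hd hc hf t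
    exact ⟨fun k => σ (k - 1), (hiff _).2 ⟨hσ, hmult⟩⟩
  · obtain ⟨hmono, hmult⟩ := (hiff ev).1 hev
    obtain ⟨ψ, hψ, hmem, hψt⟩ := exists_orthonormal_eigenbasis horth hfd htot hmult
    have hshift : ∀ f : ℕ → ℝ, ∑ k ∈ Finset.Icc 1 n, f k = ∑ k ∈ Finset.range n, f (k + 1) := by
      intro f
      rw [Finset.range_eq_Ico, Finset.sum_Ico_add' f 0 n 1]
      rfl
    have hform : ∑ k ∈ Finset.range n,
        weakForm sobolevEmbedding Q (sobolevSin k) (sobolevSin k) =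
        ∑ k ∈ Finset.Icc 1 n, ((k : ℝ) ^ 2 + cosCoeff q 0 / 2) +
          -(1 / 2) * ∑ k ∈ Finset.Icc 1 n, cosCoeff q (2 * k) := by
      rw [hshift, hshift, Finset.mul_sum, ← Finset.sum_add_distrib]
      refine Finset.sum_congr rfl fun k _ => ?_
      rw [hq.weakForm_sobolevSin hg le_rfl, if_pos rfl, Nat.sub_self,
        show k + k + 2 = 2 * (k + 1) by ring]
      push_cast
      ring
    have hsum : ∑ k ∈ Finset.Icc 1 n, (ev k - (k : ℝ) ^ 2 - cosCoeff q 0 / 2) =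
        ∑ k ∈ Finset.range n, ev (k + 1) -
          ∑ k ∈ Finset.Icc 1 n, ((k : ℝ) ^ 2 + cosCoeff q 0 / 2) := by
      rw [← hshift, ← Finset.sum_sub_distrib]
      exact Finset.sum_congr rfl fun k _ => by ring
    constructor
    · have h := sum_weakEigenvalue_le hQ hc hψ hψt hmem hmono (n := n)
        (φ := fun i => sobolevSin i) (orthonormal_sinL2.comp _ Fin.val_injective)
      rw [Fin.sum_univ_eq_sum_range
        (fun i => weakForm sobolevEmbedding Q (sobolevSin i) (sobolevSin i)) n, hform] at h
      rw [hsum]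
      linarith
    · intro heq
      refine hq.const_of_periodic hn fun m hm => ?_
      -- Indices `n - 1` and `n - 1 + m`, that is, frequencies `n` and `n + m`: the off-diagonal
      -- entry is `(q_m - q_{m+2n}) / 2`.
      have h := weakForm_eq_zero_of_sum_weakEigenvalue_eq hQ hc hψ hψt hmem hmono (n := n)
        (e := sobolevSin) orthonormal_sinL2 (by rw [hform]; linarith)
        (show n - 1 < n by omega) (show n ≤ n - 1 + m by omega)
      rw [hq.weakForm_sobolevSin hg (by omega), if_neg (by omega),
        show n - 1 + m - (n - 1) = m by omega,
        show n - 1 + m + (n - 1) + 2 = m + 2 * n by omega] at h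
      linarith
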